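/- Points of $\mathbb R^3$ have coordinates $(x,y,z)$, with $z$ vertical. A brick is a cuboid with positive side lengths and edges parallel to the axes. Let a connected solid $P\subset\mathbb R^3$ be partitioned into finitely many (maximal) bricks, any two of which are either disjoint or touch only at the top face of one and the bottom face of the other, in a rectangle called their contact rectangle. A contact rectangle is primitive if it is bordered by exactly one reflex edge, that is, if three of its sides lie on sides of the horizontal faces of both bricks while the fourth lies on a side of only one of the two. If all contact rectangles are primitive, $P$ is a stack. A castle is a stack in which each brick has either zero or two other bricks attached to its top face; its bottom brick is called the base brick. A double castle is the shape obtained by turning a castle upside down and attaching its base brick, via a primitive contact rectangle, to the base brick of another castle lying above it. A reflex edge of $P$ is an edge (a maximal segment) whose interior dihedral angle is $270^\circ$. Two points see each other in $P$ if the segment joining them is contained in $P$. A set of closed (respectively open) reflex edge guards is a set of reflex edges taken with (respectively without) their endpoints; it guards $P$ if each point of $P$ is seen by some point of some guard. **Lemma.** Every double castle has a finite and odd number $r$ of reflex edges, and it can be guarded by at most $\lfloor r/2\rfloor+1$ closed reflex edge guards, and also by at most $\lfloor r/2\rfloor+1$ open reflex edge guards. -/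

import Mathlib

namespace OrthoPoly

open Set Filter Topology

/-- Points of three-dimensional space; coordinate `2` is the vertical one. -/
abbrev Pt : Type := Fin 3 → ℝ

/-- An axis-parallel cuboid, given by its two extreme corners. -/
structure Brick where
  lo : Pt
  hi : Pt
  lo_lt_hi : ∀ i, lo i < hi i

/-- The (closed) solid occupied by a brick. -/
def Brick.solid (B : Brick) : Set Pt := Icc B.lo B.hi

/-- `B.SitsOn A`: the bottom face of `B` and the top face of `A` lie in the same horizontal plane
and meet in a (non-degenerate) rectangle, the contact rectangle of the two bricks. -/
def Brick.SitsOn (B A : Brick) : Prop :=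
  A.hi 2 = B.lo 2 ∧ ∀ i, i ≠ 2 → max (A.lo i) (B.lo i) < min (A.hi i) (B.hi i)

/-- The horizontal rectangle of `B` is obtained from that of `A` by pushing exactly one of the four
sides strictly inwards: the other three sides are flush. -/
def Brick.NarrowerThan (B A : Brick) : Prop :=
  ∃ i j : Fin 3, i ≠ 2 ∧ j ≠ 2 ∧ i ≠ j ∧
    B.lo j = A.lo j ∧ B.hi j = A.hi j ∧
    ((B.lo i = A.lo i ∧ B.hi i < A.hi i) ∨ (A.lo i < B.lo i ∧ B.hi i = A.hi i))

/-- `B` sits on `A` through a primitive contact rectangle, that is, one bordered by exactly one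
reflex edge: three of its sides are flush with both bricks, and the fourth side is
a side of only one of the two bricks (the upper or the lower one). -/
def PrimitiveContact (A B : Brick) : Prop :=
  B.SitsOn A ∧ (B.NarrowerThan A ∨ A.NarrowerThan B)

/-- `Q` is the partition into bricks of the connected solid `P`, all of whose reflex edges are
horizontal. -/
structure IsBrickPartition (P : Set Pt) (Q : Set Brick) : Prop where
  finite : Q.Finite
  union_eq : ⋃ B ∈ Q, B.solid = P
  connected : IsConnected P
  touch : ∀ A ∈ Q, ∀ B ∈ Q, A ≠ B → Disjoint A.solid B.solid ∨ B.SitsOn A ∨ A.SitsOn B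
  maximal : ∀ A ∈ Q, ∀ B ∈ Q, B.SitsOn A → ∃ i, i ≠ 2 ∧ (B.lo i ≠ A.lo i ∨ B.hi i ≠ A.hi i)

/-- `P`, with brick partition `Q`, is a stack: all its contact rectangles are primitive. At any
point at most two bricks of a stack meet, and they do so along a primitive contact rectangle,
so a stack is always a 3-manifold with boundary. -/
structure IsStack (P : Set Pt) (Q : Set Brick) : Prop extends IsBrickPartition P Q where
  primitive : ∀ A ∈ Q, ∀ B ∈ Q, B.SitsOn A → PrimitiveContact A B

/-- `P`, with brick partition `Q`, is a castle: a stack in which either zero or two bricks are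
attached to the top face of each brick. -/
structure IsCastle (P : Set Pt) (Q : Set Brick) : Prop extends IsStack P Q where
  zero_or_two : ∀ A ∈ Q, {B ∈ Q | B.SitsOn A}.ncard = 0 ∨ {B ∈ Q | B.SitsOn A}.ncard = 2

/-- `B` is a bottom brick of the collection `Q` (in a castle there is only one). -/
def IsBaseBrick (Q : Set Brick) (B : Brick) : Prop :=
  B ∈ Q ∧ ∀ A ∈ Q, B.lo 2 ≤ A.lo 2

/-- Turning a point upside down: the rotation by a half turn about the axis of
coordinate `0`. -/
def turn (p : Pt) : Pt := ![p 0, -p 1, -p 2]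

/-- Turning a brick upside down. -/
def Brick.turn (B : Brick) : Brick where
  lo := ![B.lo 0, -B.hi 1, -B.hi 2]
  hi := ![B.hi 0, -B.lo 1, -B.lo 2]
  lo_lt_hi := by
    intro i
    fin_cases i
    · simpa using B.lo_lt_hi 0
    · simpa using B.lo_lt_hi 1
    · simpa using B.lo_lt_hi 2

/-- The two operations called `turn` agree. -/
theorem Brick.solid_turn (B : Brick) : B.turn.solid = OrthoPoly.turn '' B.solid := by
  ext p
  simp only [Brick.solid, Brick.turn, mem_image, mem_Icc, Pi.le_def, Fin.forall_fin_succ,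
    IsEmpty.forall_iff, and_true]
  constructor
  · rintro h
    refine ⟨OrthoPoly.turn p, ?_, ?_⟩
    · simp [OrthoPoly.turn] at h ⊢
      refine ⟨⟨?_, ?_, ?_⟩, ?_, ?_, ?_⟩ <;> linarith
    · ext i
      fin_cases i <;> simp [OrthoPoly.turn]
  · rintro ⟨q, h, rfl⟩
    simp [OrthoPoly.turn] at h ⊢
    refine ⟨⟨?_, ?_, ?_⟩, ?_, ?_, ?_⟩ <;> linarith

/-- A double castle: a castle `C₂`, turned upside down, and a castle `C₁` above it, whose base bricks
are attached to each other via a primitive contact rectangle. -/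
def IsDoubleCastle (D : Set Pt) : Prop :=
  ∃ (C₁ C₂ : Set Pt) (Q₁ Q₂ : Set Brick) (B₁ B₂ : Brick),
    IsCastle C₁ Q₁ ∧ IsBaseBrick Q₁ B₁ ∧ IsCastle C₂ Q₂ ∧ IsBaseBrick Q₂ B₂ ∧
    PrimitiveContact B₂.turn B₁ ∧ D = C₁ ∪ turn '' C₂

/-- Near `p`, the solid `P` is the complement of an open quadrant times a line in direction `i`:
`p` is interior to an edge in direction `i` with interior dihedral angle of 270 degrees. -/
def IsReflexPoint (P : Set Pt) (i : Fin 3) (p : Pt) : Prop :=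
  ∃ σ : Fin 3 → ℝ, (∀ j, σ j ≠ 0) ∧
    ∀ᶠ q in 𝓝 p, (q ∈ P ↔ ∃ j, j ≠ i ∧ σ j * (q j - p j) ≤ 0)

/-- The reflex edges of `P`: maximal segments of reflex points, each given by its endpoints, listed
in increasing order of the coordinate in which they differ. -/
def reflexEdges (P : Set Pt) : Set (Pt × Pt) :=
  {e | ∃ i, e.1 i < e.2 i ∧ (∀ j, j ≠ i → e.1 j = e.2 j) ∧
    (∀ p ∈ openSegment ℝ e.1 e.2, IsReflexPoint P i p) ∧
    ¬ IsReflexPoint P i e.1 ∧ ¬ IsReflexPoint P i e.2}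

/-- Two points see each other within `P` if the segment joining them is contained in `P`. -/
def Sees (P : Set Pt) (x y : Pt) : Prop := segment ℝ x y ⊆ P

/-- The closed edge guards in `G` (segments with their endpoints) guard all of `P`. -/
def GuardedByClosed (P : Set Pt) (G : Set (Pt × Pt)) : Prop :=
  ∀ y ∈ P, ∃ e ∈ G, ∃ x ∈ segment ℝ e.1 e.2, Sees P x y

/-- The open edge guards in `G` (segments without their endpoints) guard all of `P`. -/
def GuardedByOpen (P : Set Pt) (G : Set (Pt × Pt)) : Prop :=
  ∀ y ∈ P, ∃ e ∈ G, ∃ x ∈ openSegment ℝ e.1 e.2, Sees P x y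

end OrthoPoly

/-!
Every contact rectangle carries exactly one reflex edge, and there are no others. A castle with `k`
branching bricks is a binary tree with `2 * k` contacts, so two castles with `k` and `k'` branching
bricks make a double castle with `r = 2 * (k + k') + 1` reflex edges, and `k + k' + 1` open guards
have to suffice.

A castle alone is lit by `k` guards and any side of the near face of its base brick: at a branching,
the base brick shares part of that side with a child, whose castle is lit by induction, and the
other child's castle is lit with the help of the reflex edge at its own contact. For a double
castle, use the central contact edge as a guard, unless the wider base brick branches parallel to
it. In that case, the child on the far side of the branching and the wider base brick itself are
dealt with by the reflex edge at that child's contact; the other child and the narrower base brick,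
one of them extended through the wider base brick, are the base bricks of a smaller double castle.
-/

namespace OrthoPoly

open Set Filter Topology

section Bricks

/-- `i` and `j` are the two horizontal directions, in some order. -/
structure HorizontalPair (i j : Fin 3) : Prop where
  left : i ≠ 2
  right : j ≠ 2
  ne : i ≠ j

theorem HorizontalPair.symm {i j : Fin 3} (h : HorizontalPair i j) : HorizontalPair j i :=
  ⟨h.right, h.left, h.ne.symm⟩

theorem HorizontalPair.eq_or_eq {i j n : Fin 3} (h : HorizontalPair i j) :
    n = i ∨ n = j ∨ n = 2 := by
  obtain ⟨hi, hj, hij⟩ := h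
  revert i j n
  decide

theorem HorizontalPair.eq_or_eq_swap {i j i' j' : Fin 3} (h : HorizontalPair i j)
    (h' : HorizontalPair i' j') : (i' = i ∧ j' = j) ∨ (i' = j ∧ j' = i) := by
  obtain ⟨hi, hj, hij⟩ := h
  obtain ⟨hi', hj', hij'⟩ := h'
  revert i j i' j'
  decide

/-- The sign of the outward normal at the upper (`true`) or lower (`false`) of the two faces of a
brick orthogonal to some direction. -/
def orient (b : Bool) : ℝ := cond b 1 (-1)

@[simp] theorem orient_not (b : Bool) : orient (!b) = -orient b := by cases b <;> simp [orient]

@[simp] theorem orient_mul_orient (b : Bool) : orient b * orient b = 1 := by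
  cases b <;> simp [orient]

theorem orient_ne_zero (b : Bool) : orient b ≠ 0 := by cases b <;> simp [orient]

theorem orient_mul_cancel {b : Bool} {x y : ℝ} : orient b * x = orient b * y ↔ x = y :=
  mul_right_inj' (orient_ne_zero b)

/-- The coordinate of the face of `B` orthogonal to the direction `n` on the side `b`. -/
def Brick.side (B : Brick) (n : Fin 3) (b : Bool) : ℝ := cond b (B.hi n) (B.lo n)

/-- The support function of `B` at the outward normal of its face orthogonal to the direction `n` on
the side `b`. Expressed in terms of it, every argument is the same on all sides. -/
def Brick.support (B : Brick) (n : Fin 3) (b : Bool) : ℝ := orient b * B.side n b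

variable {A B : Brick} {Q : Set Brick} {p : Pt} {i j n : Fin 3} {b c : Bool} {v : ℝ}

theorem Brick.support_true : B.support n true = B.hi n := one_mul _

theorem Brick.support_false : B.support n false = -B.lo n := neg_one_mul _

theorem Brick.side_eq_side_iff : A.side n b = B.side n b ↔ A.support n b = B.support n b :=
  orient_mul_cancel.symm

theorem Brick.side_eq_side_not_iff :
    A.side n b = B.side n (!b) ↔ A.support n b + B.support n (!b) = 0 := by
  cases b <;> simp only [side, cond_true, cond_false, Bool.not_true, Bool.not_false, support_true,
    support_false] <;> constructor <;> intro h <;> linarith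

theorem Brick.mem_solid_iff : p ∈ B.solid ↔ ∀ n b, orient b * p n ≤ B.support n b := by
  simp [solid, Pi.le_def, Bool.forall_bool, support, side, orient, forall_and]

theorem Brick.support_add_support_not_pos (B : Brick) (n : Fin 3) (b : Bool) :
    0 < B.support n b + B.support n (!b) := by
  have := B.lo_lt_hi n
  cases b <;> simp only [Bool.not_true, Bool.not_false, support_true, support_false] <;> linarith

theorem Brick.eq_of_support_eq (h : ∀ n b, A.support n b = B.support n b) : A = B := by
  have hlo : A.lo = B.lo := funext fun n ↦ by
    simpa only [support_false, neg_inj] using h n false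
  have hhi : A.hi = B.hi := funext fun n ↦ by simpa only [support_true] using h n true
  cases A; cases B; cases hlo; cases hhi; rfl

theorem Brick.solid_subset_of_support_le (h : ∀ n b, A.support n b ≤ B.support n b) :
    A.solid ⊆ B.solid := fun _ hp ↦
  mem_solid_iff.2 fun n b ↦ (mem_solid_iff.1 hp n b).trans (h n b)

theorem Brick.exists_support_add_neg_of_disjoint (h : Disjoint A.solid B.solid) :
    ∃ n b, A.support n b + B.support n (!b) < 0 := by
  rw [Set.disjoint_iff_inter_eq_empty, solid, solid, Icc_inter_Icc, Icc_eq_empty_iff,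
    Pi.le_def] at h
  push Not at h
  obtain ⟨n, hn⟩ := h
  rw [Pi.sup_apply, Pi.inf_apply, inf_lt_iff, lt_sup_iff, lt_sup_iff] at hn
  have hA := A.lo_lt_hi n
  have hB := B.lo_lt_hi n
  rcases hn with (hn | hn) | (hn | hn)
  · exact absurd hA hn.not_gt
  · exact ⟨n, true, by rw [Bool.not_true, support_true, support_false]; linarith⟩
  · exact ⟨n, false, by rw [Bool.not_false, support_true, support_false]; linarith⟩
  · exact absurd hB hn.not_gt

theorem Brick.support_add_support_not_nonneg (hA : p ∈ A.solid) (hB : p ∈ B.solid) (n : Fin 3)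
    (b : Bool) : 0 ≤ A.support n b + B.support n (!b) := by
  have hA := mem_solid_iff.1 hA n b
  have hB := mem_solid_iff.1 hB n (!b)
  rw [orient_not] at hB
  linarith

/-- The union of the bricks in `Q`. -/
def solidOf (Q : Set Brick) : Set Pt := ⋃ B ∈ Q, B.solid

theorem mem_solidOf : p ∈ solidOf Q ↔ ∃ B ∈ Q, p ∈ B.solid := mem_iUnion₂.trans (by simp)

theorem solidOf_insert (B : Brick) (Q : Set Brick) :
    solidOf (insert B Q) = B.solid ∪ solidOf Q := biUnion_insert ..

theorem solidOf_insert_empty (B : Brick) : solidOf (insert B ∅) = B.solid := by simp [solidOf]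

theorem solidOf_union (Q Q' : Set Brick) : solidOf (Q ∪ Q') = solidOf Q ∪ solidOf Q' :=
  biUnion_union ..

/-- The point of the horizontal line in direction `j` at height `z` and offset `v`, with
coordinate `t` along the line. -/
def linePt (j : Fin 3) (v z t : ℝ) : Pt := Function.update (Function.update (fun _ ↦ v) 2 z) j t

theorem linePt_self (j : Fin 3) (v z t : ℝ) : linePt j v z t j = t := Function.update_self ..

theorem HorizontalPair.linePt_two (h : HorizontalPair i j) (v z t : ℝ) : linePt j v z t 2 = z := by
  simp [linePt, h.right.symm]

theorem HorizontalPair.linePt_left (h : HorizontalPair i j) (v z t : ℝ) :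
    linePt j v z t i = v := by
  simp [linePt, h.left, h.ne]

theorem openSegment_linePt (j : Fin 3) (v z : ℝ) {a b : ℝ} (hab : a < b) :
    openSegment ℝ (linePt j v z a) (linePt j v z b) = linePt j v z '' Ioo a b := by
  rw [← openSegment_eq_Ioo hab]
  exact (Pi.image_update_openSegment ..).symm

/-- The open segment in direction `j` at offset `v` which crosses the horizontal face of `B` on the
side `b`. -/
def Brick.chord (B : Brick) (j : Fin 3) (v : ℝ) (b : Bool) : Set Pt :=
  linePt j v (B.side 2 b) '' Ioo (B.lo j) (B.hi j)

/-- The edge of `B` in direction `j` which lies on the side `c` in direction `i` and on the side `b`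
in the vertical direction. -/
def Brick.edge (B : Brick) (i j : Fin 3) (c b : Bool) : Pt × Pt :=
  (linePt j (B.side i c) (B.side 2 b) (B.lo j), linePt j (B.side i c) (B.side 2 b) (B.hi j))

theorem Brick.openSegment_edge (B : Brick) (i j : Fin 3) (c b : Bool) :
    openSegment ℝ (B.edge i j c b).1 (B.edge i j c b).2 = B.chord j (B.side i c) b :=
  openSegment_linePt _ _ _ (B.lo_lt_hi j)

theorem Brick.chord_nonempty (B : Brick) (j : Fin 3) (v : ℝ) (b : Bool) :
    (B.chord j v b).Nonempty := (nonempty_Ioo.2 (B.lo_lt_hi j)).image _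

theorem Brick.chord_subset_chord (hj : ∀ b, A.support j b ≤ B.support j b)
    (h2 : A.side 2 b = B.side 2 c) : A.chord j v b ⊆ B.chord j v c := by
  rw [chord, chord, h2]
  refine image_mono (Ioo_subset_Ioo ?_ ?_)
  · simpa only [support_false, neg_le_neg_iff] using hj false
  · simpa only [support_true] using hj true

theorem Brick.chord_subset_solid (h : HorizontalPair i j)
    (hv : ∀ c, orient c * v ≤ B.support i c) : B.chord j v b ⊆ B.solid := by
  rintro _ ⟨t, ht, rfl⟩
  refine mem_solid_iff.2 fun n c ↦ ?_
  rcases h.eq_or_eq (n := n) with rfl | rfl | rfl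
  · rw [h.linePt_left]
    exact hv c
  · rw [linePt_self]
    cases c <;> simp [support, side, orient, ht.1.le, ht.2.le]
  · rw [h.linePt_two]
    have := (B.lo_lt_hi 2).le
    cases b <;> cases c <;> simp [support, side, orient, this]

theorem Brick.orient_mul_side_le (B : Brick) (n : Fin 3) (b c : Bool) :
    orient c * B.side n b ≤ B.support n c := by
  have := (B.lo_lt_hi n).le
  cases b <;> cases c <;> simp [support, side, orient, this]

end Bricks

section Lighting

/-- Each point of `S` is seen, within `D`, by a point of `L`. -/
def Lit (D L S : Set Pt) : Prop := ∀ p ∈ S, ∃ x ∈ L, Sees D x p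

/-- The points of the open segments in `G`. -/
def edgePts (G : Set (Pt × Pt)) : Set Pt := ⋃ e ∈ G, openSegment ℝ e.1 e.2

/-- `S` is lit, within `D`, by `L` together with at most `m` open guards from `E`. -/
def LitWith (D : Set Pt) (E : Set (Pt × Pt)) (L : Set Pt) (m : ℕ) (S : Set Pt) : Prop :=
  ∃ G ⊆ E, G.ncard ≤ m ∧ Lit D (L ∪ edgePts G) S

section LitWith

variable {D L L' S S' : Set Pt} {E : Set (Pt × Pt)} {m m' : ℕ}

theorem LitWith.mono (h : LitWith D E L m S) (hL : L ⊆ L') (hm : m ≤ m') (hS : S' ⊆ S) :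
    LitWith D E L' m' S' := by
  obtain ⟨G, hG, hcard, hlit⟩ := h
  refine ⟨G, hG, hcard.trans hm, fun p hp ↦ ?_⟩
  obtain ⟨x, hx, hxp⟩ := hlit p (hS hp)
  exact ⟨x, union_subset_union_left _ hL hx, hxp⟩

theorem LitWith.union (h : LitWith D E L m S) (h' : LitWith D E L m' S') :
    LitWith D E L (m + m') (S ∪ S') := by
  obtain ⟨G, hG, hcard, hlit⟩ := h
  obtain ⟨G', hG', hcard', hlit'⟩ := h'
  refine ⟨G ∪ G', union_subset hG hG',
    (ncard_union_le _ _).trans (add_le_add hcard hcard'), ?_⟩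
  rw [edgePts, biUnion_union]
  rintro p (hp | hp)
  · obtain ⟨x, hx, hxp⟩ := hlit p hp
    exact ⟨x, union_subset_union_right _ subset_union_left hx, hxp⟩
  · obtain ⟨x, hx, hxp⟩ := hlit' p hp
    exact ⟨x, union_subset_union_right _ subset_union_right hx, hxp⟩

theorem LitWith.insert_guard {e : Pt × Pt} (he : e ∈ E)
    (h : LitWith D E (L ∪ openSegment ℝ e.1 e.2) m S) : LitWith D E L (m + 1) S := by
  obtain ⟨G, hG, hcard, hlit⟩ := h
  refine ⟨insert e G, insert_subset he hG,
    (ncard_insert_le _ _).trans (Nat.succ_le_succ hcard), ?_⟩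
  rwa [edgePts, biUnion_insert, ← union_assoc]

theorem LitWith.of_inter_nonempty {B : Brick} (hB : B.solid ⊆ D) (hL : (B.solid ∩ L).Nonempty) :
    LitWith D E L 0 B.solid := by
  obtain ⟨x, hxB, hxL⟩ := hL
  exact ⟨∅, empty_subset _, by simp, fun p hp ↦ ⟨x, subset_union_left hxL,
    ((convex_Icc _ _).segment_subset hxB hp).trans hB⟩⟩

theorem LitWith.of_chord_subset {B : Brick} {i j : Fin 3} {v : ℝ} {b : Bool}
    (hij : HorizontalPair i j) (hB : B.solid ⊆ D) (hv : ∀ c, orient c * v ≤ B.support i c)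
    (hL : B.chord j v b ⊆ L) : LitWith D E L 0 B.solid :=
  of_inter_nonempty hB ((B.chord_nonempty j v b).mono
    (subset_inter (Brick.chord_subset_solid hij hv) hL))

end LitWith

/-- The horizontal rectangle of `B` is obtained from that of `A` by pushing its side `c` in
direction `i` (weakly) inwards, and leaving the other three sides in their place. -/
structure Brick.PushedIn (B A : Brick) (i j : Fin 3) (c : Bool) : Prop where
  pair : HorizontalPair i j
  across : ∀ b, B.support j b = A.support j b
  flush : B.support i (!c) = A.support i (!c)
  pushed : B.support i c ≤ A.support i c

/-- `B` is the result of moving the horizontal face of `B₀` on the side opposite to `d` outwards. -/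
structure Brick.Extends (d : Bool) (B B₀ : Brick) : Prop where
  horizontal : ∀ n, n ≠ 2 → ∀ b, B.support n b = B₀.support n b
  far : B.support 2 d = B₀.support 2 d
  near : B₀.support 2 (!d) ≤ B.support 2 (!d)

variable {A B B₀ B₁ B₂ : Brick} {i j n : Fin 3} {b c d : Bool}

theorem Brick.PushedIn.support_le (h : B.PushedIn A i j c) (hn : n ≠ 2) (b : Bool) :
    B.support n b ≤ A.support n b := by
  rcases h.pair.eq_or_eq (n := n) with rfl | rfl | rfl
  · obtain rfl | rfl : b = c ∨ b = !c := Bool.eq_or_eq_not b c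
    · exact h.pushed
    · exact h.flush.le
  · exact (h.across b).le
  · exact absurd rfl hn

theorem Brick.PushedIn.congr {A' B' : Brick} (h : B.PushedIn A i j c)
    (hB : ∀ n, n ≠ 2 → ∀ b, B'.support n b = B.support n b)
    (hA : ∀ n, n ≠ 2 → ∀ b, A'.support n b = A.support n b) : B'.PushedIn A' i j c where
  pair := h.pair
  across b := by rw [hB j h.pair.right, hA j h.pair.right, h.across]
  flush := by rw [hB i h.pair.left, hA i h.pair.left, h.flush]
  pushed := by rw [hB i h.pair.left, hA i h.pair.left]; exact h.pushed

theorem Brick.PushedIn.of_le (h : B.PushedIn A i j c) (h₁ : B₁.PushedIn A i j c)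
    (hle : B.support i c ≤ B₁.support i c) : B.PushedIn B₁ i j c where
  pair := h.pair
  across b := (h.across b).trans (h₁.across b).symm
  flush := h.flush.trans h₁.flush.symm
  pushed := hle

theorem Brick.Extends.refl (d : Bool) (B : Brick) : Extends d B B :=
  ⟨fun _ _ _ ↦ rfl, rfl, le_rfl⟩

theorem Brick.exists_extends (d : Bool) (B₀ : Brick) {t : ℝ} (ht : B₀.support 2 (!d) ≤ t) :
    ∃ B, Extends d B B₀ ∧ B.support 2 (!d) = t := by
  cases d with
  | true =>
    rw [Bool.not_true, support_false] at ht
    refine ⟨⟨Function.update B₀.lo 2 (-t), B₀.hi, fun n ↦ ?_⟩, ⟨fun n hn b ↦ ?_, rfl, ?_⟩, ?_⟩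
    · rcases eq_or_ne n 2 with rfl | hn
      · simpa using (neg_le.1 ht).trans_lt (B₀.lo_lt_hi 2)
      · simpa [hn] using B₀.lo_lt_hi n
    · cases b <;> simp [support, side, hn]
    · simpa [support_false] using ht
    · simp [support_false]
  | false =>
    rw [Bool.not_false, support_true] at ht
    refine ⟨⟨B₀.lo, Function.update B₀.hi 2 t, fun n ↦ ?_⟩, ⟨fun n hn b ↦ ?_, rfl, ?_⟩, ?_⟩
    · rcases eq_or_ne n 2 with rfl | hn
      · simpa using (B₀.lo_lt_hi 2).trans_le ht
      · simpa [hn] using B₀.lo_lt_hi n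
    · cases b <;> simp [support, side, hn]
    · simpa [support_true] using ht
    · simp [support_true]

theorem Brick.Extends.solid_subset (h : Extends d B B₀)
    (hn : ∀ n, n ≠ 2 → ∀ b, B₀.support n b ≤ A.support n b)
    (h2 : B₀.support 2 (!d) + A.support 2 d = 0) (hB : B.support 2 (!d) ≤ A.support 2 (!d)) :
    B.solid ⊆ A.solid ∪ B₀.solid := by
  intro p hp
  rw [mem_solid_iff] at hp
  have hd := hp 2 d
  have hd' := hp 2 (!d)
  rw [h.far] at hd
  rw [orient_not] at hd'
  rcases le_total (-orient d * p 2) (B₀.support 2 (!d)) with hle | hle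
  · refine Or.inr (mem_solid_iff.2 fun n b ↦ ?_)
    rcases eq_or_ne n 2 with rfl | hn2
    · obtain rfl | rfl := Bool.eq_or_eq_not b d
      · exact hd
      · rwa [orient_not]
    · exact (hp n b).trans (h.horizontal n hn2 b).le
  · refine Or.inl (mem_solid_iff.2 fun n b ↦ ?_)
    rcases eq_or_ne n 2 with rfl | hn2
    · obtain rfl | rfl := Bool.eq_or_eq_not b d
      · linarith
      · rw [orient_not]
        exact hd'.trans hB
    · exact (hp n b).trans ((h.horizontal n hn2 b).le.trans (hn n hn2 b))

/-- The bricks `B₁` and `B₂` are attached to the horizontal face of `B` on the side `d`: their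
rectangles are obtained from that of `B` by pushing the side `c` in direction `i`, respectively the
opposite side, inwards, so far that they are disjoint. -/
structure Branching (d : Bool) (i j : Fin 3) (c : Bool) (B B₁ B₂ : Brick) : Prop where
  left : B₁.PushedIn B i j c
  right : B₂.PushedIn B i j (!c)
  left_height : B₁.support 2 (!d) + B.support 2 d = 0
  right_height : B₂.support 2 (!d) + B.support 2 d = 0
  gap : B₁.support i c + B₂.support i (!c) < 0

theorem Branching.symm (h : Branching d i j c B B₁ B₂) : Branching d i j (!c) B B₂ B₁ where
  left := h.right
  right := by rw [Bool.not_not]; exact h.left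
  left_height := h.right_height
  right_height := h.left_height
  gap := by rw [Bool.not_not, add_comm]; exact h.gap

theorem Branching.of_extends (h : Branching d i j c B₀ B₁ B₂) (hB : B.Extends d B₀) :
    Branching d i j c B B₁ B₂ where
  left := h.left.congr (fun _ _ _ ↦ rfl) hB.horizontal
  right := h.right.congr (fun _ _ _ ↦ rfl) hB.horizontal
  left_height := by rw [hB.far, h.left_height]
  right_height := by rw [hB.far, h.right_height]
  gap := h.gap

end Lighting

/-- A castle growing in the vertical direction `d`, as a binary tree of bricks: `B` is its base
brick, `T` consists of its other bricks, and `k` is the number of bricks to which two others are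
attached. The edges of the bricks in `T` at which they are pushed in belong to `E`. -/
inductive CastleOn (E : Set (Pt × Pt)) (d : Bool) : Brick → Set Brick → ℕ → Prop
  | leaf (B : Brick) : CastleOn E d B ∅ 0
  | node {B B₁ B₂ : Brick} {T₁ T₂ : Set Brick} {k₁ k₂ : ℕ} {i j : Fin 3} {c : Bool}
      (h : Branching d i j c B B₁ B₂) (he₁ : B₁.edge i j c (!d) ∈ E)
      (he₂ : B₂.edge i j (!c) (!d) ∈ E) (H₁ : CastleOn E d B₁ T₁ k₁)
      (H₂ : CastleOn E d B₂ T₂ k₂) :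
      CastleOn E d B (insert B₁ T₁ ∪ insert B₂ T₂) (k₁ + k₂ + 1)

/-- The castle with base brick `B₀` and further bricks `T`, its base brick extended in any way, is
lit by `k` guards and any side of the near face of its base brick. -/
def SideLit (D : Set Pt) (E : Set (Pt × Pt)) (d : Bool) (B₀ : Brick) (T : Set Brick) (k : ℕ) :
    Prop :=
  ∀ ⦃B⦄, B.Extends d B₀ → solidOf (insert B T) ⊆ D → ∀ ⦃i j c L⦄, HorizontalPair i j →
    B.chord j (B.side i c) (!d) ⊆ L → LitWith D E L k (solidOf (insert B T))

/-- The castle with base brick `B₀` and further bricks `T`, its base brick extended in any way, is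
lit by `k` guards and any line crossing the near face of its base brick at a right angle to an edge
of `B₀` which can be used as a guard. -/
def CrossLit (D : Set Pt) (E : Set (Pt × Pt)) (d : Bool) (B₀ : Brick) (T : Set Brick) (k : ℕ) :
    Prop :=
  ∀ ⦃B⦄, B.Extends d B₀ → solidOf (insert B T) ⊆ D → ∀ ⦃i j c v L⦄, HorizontalPair i j →
    B₀.edge j i c (!d) ∈ E → (∀ b, orient b * v ≤ B₀.support i b) →
    B.chord j v (!d) ⊆ L → LitWith D E L k (solidOf (insert B T))

section Castles

variable {D L : Set Pt} {E : Set (Pt × Pt)} {B B₀ B₁ B₂ N : Brick} {T T₁ T₂ : Set Brick}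
  {i j i₀ j₀ : Fin 3} {b c c₀ d : Bool} {v : ℝ} {k k₁ k₂ : ℕ}

theorem Brick.Extends.support_le (h : B.Extends d B₀) (n : Fin 3) (b : Bool) :
    B₀.support n b ≤ B.support n b := by
  rcases eq_or_ne n 2 with rfl | hn
  · obtain rfl | rfl := Bool.eq_or_eq_not b d
    · exact h.far.ge
    · exact h.near
  · exact (h.horizontal n hn b).ge

theorem CastleOn.of_extends (H : CastleOn E d B₀ T k) (hB : B.Extends d B₀) :
    CastleOn E d B T k := by
  cases H with
  | leaf => exact .leaf B
  | node h he₁ he₂ H₁ H₂ => exact .node (h.of_extends hB) he₁ he₂ H₁ H₂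

theorem Brick.PushedIn.exists_extends (h : N.PushedIn B i j c)
    (h2 : N.support 2 (!d) + B.support 2 d = 0) (hB : B.solid ⊆ D)
    (hT : solidOf (insert N T) ⊆ D) :
    ∃ N', N'.Extends d N ∧ N'.support 2 (!d) = B.support 2 (!d) ∧
      solidOf (insert N' T) ⊆ D ∧ solidOf (insert N T) ⊆ solidOf (insert N' T) := by
  have hle : N.support 2 (!d) ≤ B.support 2 (!d) := by
    linarith [B.support_add_support_not_pos 2 d]
  obtain ⟨N', hN', hN'2⟩ := Brick.exists_extends d N hle
  rw [solidOf_insert, union_subset_iff] at hT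
  simp only [solidOf_insert]
  refine ⟨N', hN', hN'2, union_subset ?_ hT.2,
    union_subset_union_left _ (Brick.solid_subset_of_support_le hN'.support_le)⟩
  exact (hN'.solid_subset (fun n hn ↦ h.support_le hn) h2 hN'2.le).trans (union_subset hB hT.1)

theorem SideLit.guard (ih : SideLit D E d B T k) (hT : solidOf (insert B T) ⊆ D)
    (hij : HorizontalPair i j) (he : B.edge i j c (!d) ∈ E) :
    LitWith D E L (k + 1) (solidOf (insert B T)) := by
  refine LitWith.insert_guard he (ih (.refl d B) hT hij (c := c) ?_)
  rw [Brick.openSegment_edge]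
  exact subset_union_right

theorem SideLit.child (ih : SideLit D E d B₁ T k) (h : Branching d i₀ j₀ c₀ B B₁ B₂)
    (hB : B.solid ⊆ D) (hT : solidOf (insert B₁ T) ⊆ D) (hij : HorizontalPair i j)
    (hflush : i = i₀ → c = !c₀) (hL : B.chord j (B.side i c) (!d) ⊆ L) :
    LitWith D E L k (solidOf (insert B₁ T)) := by
  obtain ⟨N, hN, hN2, hND, hsub⟩ := h.left.exists_extends h.left_height hB hT
  have hpush : N.PushedIn B i₀ j₀ c₀ := h.left.congr hN.horizontal fun _ _ _ ↦ rfl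
  refine (ih hN hND hij (c := c) ?_).mono subset_rfl le_rfl hsub
  have hside : N.side i c = B.side i c := by
    rw [Brick.side_eq_side_iff]
    rcases h.left.pair.eq_or_eq_swap hij with ⟨rfl, rfl⟩ | ⟨rfl, rfl⟩
    · rw [hflush rfl, hpush.flush]
    · exact hpush.across c
  rw [hside]
  exact (Brick.chord_subset_chord (fun b ↦ hpush.support_le hij.right b)
    (Brick.side_eq_side_iff.2 hN2)).trans hL

theorem CastleOn.sideLit (H : CastleOn E d B₀ T k) : SideLit D E d B₀ T k := by
  induction H with
  | leaf B₀ =>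
    intro B _ hD i j c L hij hL
    rw [solidOf_insert_empty] at hD ⊢
    exact LitWith.of_chord_subset hij hD (B.orient_mul_side_le i c) hL
  | @node B₀ B₁ B₂ T₁ T₂ k₁ k₂ i₀ j₀ c₀ h he₁ he₂ _ _ ih₁ ih₂ =>
    intro B hB hD i j c L hij hL
    simp only [solidOf_insert B, solidOf_union, union_subset_iff] at hD ⊢
    obtain ⟨hDB, hD₁, hD₂⟩ := hD
    have h := h.of_extends hB
    have root : LitWith D E L 0 B.solid :=
      LitWith.of_chord_subset hij hDB (B.orient_mul_side_le i c) hL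
    suffices LitWith D E L (k₁ + k₂ + 1) (solidOf (insert B₁ T₁) ∪ solidOf (insert B₂ T₂)) from
      (root.union this).mono subset_rfl (by omega) subset_rfl
    by_cases hc₁ : i = i₀ → c = !c₀
    · have lit₁ := ih₁.child h hDB hD₁ hij hc₁ hL
      exact (lit₁.union (ih₂.guard hD₂ h.left.pair he₂)).mono subset_rfl (by omega) subset_rfl
    · have hc₂ : i = i₀ → c = !!c₀ := by simpa using fun _ ↦ (Classical.not_imp.1 hc₁).2
      have lit₂ := ih₂.child h.symm hDB hD₂ hij hc₂ hL
      exact ((ih₁.guard hD₁ h.left.pair he₁).union lit₂).mono subset_rfl (by omega) subset_rfl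

theorem CrossLit.child (ih : CrossLit D E d B₁ T k) (h : Branching d j i c B B₁ B₂)
    (hB : B.solid ⊆ D) (hT : solidOf (insert B₁ T) ⊆ D) (he : B₁.edge j i c (!d) ∈ E)
    (hv : ∀ b, orient b * v ≤ B.support i b) (hL : B.chord j v (!d) ⊆ L) :
    LitWith D E L k (solidOf (insert B₁ T)) := by
  obtain ⟨N, hN, hN2, hND, hsub⟩ := h.left.exists_extends h.left_height hB hT
  have hpush : N.PushedIn B j i c := h.left.congr hN.horizontal fun _ _ _ ↦ rfl
  have hij := h.left.pair.symm
  refine (ih hN hND hij he (v := v) (fun b ↦ ?_) ?_).mono subset_rfl le_rfl hsub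
  · exact (hv b).trans (h.left.across b).ge
  · exact (Brick.chord_subset_chord (fun b ↦ hpush.support_le hij.right b)
      (Brick.side_eq_side_iff.2 hN2)).trans hL

theorem CastleOn.crossLit (H : CastleOn E d B₀ T k) : CrossLit D E d B₀ T k := by
  induction H with
  | leaf B₀ =>
    intro B hB hD i j c v L hij he hv hL
    rw [solidOf_insert_empty] at hD ⊢
    exact LitWith.of_chord_subset hij hD (fun b ↦ (hv b).trans (hB.support_le i b)) hL
  | @node B₀ B₁ B₂ T₁ T₂ k₁ k₂ i₀ j₀ c₀ h he₁ he₂ H₁ H₂ ih₁ ih₂ =>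
    intro B hB hD i j c v L hij he hv hL
    simp only [solidOf_insert B, solidOf_union, union_subset_iff] at hD ⊢
    obtain ⟨hDB, hD₁, hD₂⟩ := hD
    have hvB : ∀ b, orient b * v ≤ B.support i b := fun b ↦ (hv b).trans (hB.support_le i b)
    have root : LitWith D E L 0 B.solid := LitWith.of_chord_subset hij hDB hvB hL
    suffices LitWith D E L (k₁ + k₂ + 1) (solidOf (insert B₁ T₁) ∪ solidOf (insert B₂ T₂)) from
      (root.union this).mono subset_rfl (by omega) subset_rfl
    rcases hij.eq_or_eq_swap h.left.pair with ⟨rfl, rfl⟩ | ⟨rfl, rfl⟩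
    · have hDB₀ := (Brick.solid_subset_of_support_le hB.support_le).trans hDB
      have hedge : B₀.chord i₀ (B₀.side j₀ c) (!d) ⊆
          L ∪ openSegment ℝ (B₀.edge j₀ i₀ c (!d)).1 (B₀.edge j₀ i₀ c (!d)).2 := by
        rw [Brick.openSegment_edge]
        exact subset_union_right
      exact LitWith.insert_guard he
        ((H₁.sideLit.child h hDB₀ hD₁ hij.symm (fun h ↦ absurd h.symm hij.ne) hedge).union
          (H₂.sideLit.child h.symm hDB₀ hD₂ hij.symm (fun h ↦ absurd h.symm hij.ne) hedge))
    · have h := h.of_extends hB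
      exact ((ih₁.child h hDB hD₁ he₁ hvB hL).union
        (ih₂.child h.symm hDB hD₂ he₂ hvB hL)).mono subset_rfl (by omega) subset_rfl

end Castles

/-- Two castles in `D` with base bricks `B` and `B'`, growing in opposite directions and attached to
each other at their base bricks, where `B` is the narrower one. -/
structure DoubleCastleOn (D : Set Pt) (E : Set (Pt × Pt)) (d : Bool) (i j : Fin 3) (c : Bool)
    (B : Brick) (T : Set Brick) (k : ℕ) (B' : Brick) (T' : Set Brick) (k' : ℕ) : Prop where
  narrow : CastleOn E d B T k
  wide : CastleOn E (!d) B' T' k'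
  narrow_subset : solidOf (insert B T) ⊆ D
  wide_subset : solidOf (insert B' T') ⊆ D
  contact : B.support 2 (!d) + B'.support 2 d = 0
  pushedIn : B.PushedIn B' i j c
  edge_mem : B.edge i j c (!d) ∈ E

section DoubleCastles

variable {D : Set Pt} {E : Set (Pt × Pt)} {d : Bool} {i j : Fin 3} {c : Bool}
  {B B' N F : Brick} {T T' T₁ T₂ : Set Brick} {k k' k₁ k₂ : ℕ}

theorem DoubleCastleOn.litWith_of_wide (H : DoubleCastleOn D E d i j c B T k B' T' k')
    (hwide : ∀ L, B'.chord j (B.side i c) (!!d) ⊆ L → LitWith D E L k' (solidOf (insert B' T'))) :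
    LitWith D E ∅ (k + k' + 1) (solidOf (insert B T) ∪ solidOf (insert B' T')) := by
  refine LitWith.insert_guard H.edge_mem ?_
  rw [Brick.openSegment_edge, empty_union]
  refine (H.narrow.sideLit (.refl d B) H.narrow_subset H.pushedIn.pair subset_rfl).union
    (hwide _ (Brick.chord_subset_chord (fun b ↦ (H.pushedIn.across b).ge) ?_))
  have hcontact : B.side 2 (!d) = B'.side 2 (!!d) :=
    Brick.side_eq_side_not_iff.2 (by rw [Bool.not_not]; exact H.contact)
  exact hcontact.symm

theorem DoubleCastleOn.orient_mul_side_le (H : DoubleCastleOn D E d i j c B T k B' T' k')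
    (b : Bool) : orient b * B.side i c ≤ B'.support i b :=
  (B.orient_mul_side_le i c b).trans (H.pushedIn.support_le H.pushedIn.pair.left b)

theorem DoubleCastleOn.litWith_narrow_near (H : DoubleCastleOn D E d i j c B T k B' T' k')
    (h : Branching (!d) i j c B' N F) (he : N.edge i j c (!!d) ∈ E)
    (HN : CastleOn E (!d) N T₁ k₁) (hB' : B'.solid ⊆ D) (hN : solidOf (insert N T₁) ⊆ D)
    (ih : ∀ ⦃d B T m B' T' m'⦄, m + m' ≤ k + k₁ → DoubleCastleOn D E d i j c B T m B' T' m' →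
      LitWith D E ∅ (m + m' + 1) (solidOf (insert B T) ∪ solidOf (insert B' T'))) :
    LitWith D E ∅ (k + k₁ + 1) (solidOf (insert B T) ∪ solidOf (insert N T₁)) := by
  obtain ⟨N', hN', hN'2, hN'D, hsub⟩ := h.left.exists_extends h.left_height hB' hN
  rw [Bool.not_not] at hN'2
  rcases le_total (B.support i c) (N.support i c) with hle | hle
  · refine (ih (d := d) le_rfl ⟨H.narrow, HN.of_extends hN', H.narrow_subset, hN'D, ?_, ?_,
      H.edge_mem⟩).mono subset_rfl le_rfl (union_subset_union_right _ hsub)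
    · rw [hN'2, H.contact]
    · exact (H.pushedIn.of_le h.left hle).congr (fun _ _ _ ↦ rfl) hN'.horizontal
  · obtain ⟨C, hC, hC2, hCD, hsub⟩ := H.pushedIn.exists_extends H.contact hB' H.narrow_subset
    have hNC : DoubleCastleOn D E (!d) i j c N T₁ k₁ C T k := by
      refine ⟨HN, by rw [Bool.not_not]; exact H.narrow.of_extends hC, hN, hCD, ?_, ?_, he⟩
      · rw [hC2, h.left_height]
      · exact (h.left.of_le H.pushedIn hle).congr (fun _ _ _ ↦ rfl) hC.horizontal
    exact (ih (add_comm k₁ k).le hNC).mono subset_rfl (by omega)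
      (union_subset (hsub.trans subset_union_right) subset_union_left)

theorem DoubleCastleOn.litWith_of_parallel
    (H : DoubleCastleOn D E d i j c B T k B' (insert N T₁ ∪ insert F T₂) (k₁ + k₂ + 1))
    (h : Branching (!d) i j c B' N F) (heN : N.edge i j c (!!d) ∈ E)
    (heF : F.edge i j (!c) (!!d) ∈ E) (HN : CastleOn E (!d) N T₁ k₁)
    (HF : CastleOn E (!d) F T₂ k₂)
    (ih : ∀ ⦃d B T m B' T' m'⦄, m + m' ≤ k + k₁ → DoubleCastleOn D E d i j c B T m B' T' m' →
      LitWith D E ∅ (m + m' + 1) (solidOf (insert B T) ∪ solidOf (insert B' T'))) :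
    LitWith D E ∅ (k + (k₁ + k₂ + 1) + 1)
      (solidOf (insert B T) ∪ solidOf (insert B' (insert N T₁ ∪ insert F T₂))) := by
  have hD' := H.wide_subset
  simp only [solidOf_insert B', solidOf_union, union_subset_iff] at hD'
  obtain ⟨hB', hN, hF⟩ := hD'
  have near := H.litWith_narrow_near h heN HN hB' hN ih
  have far : LitWith D E ∅ (k₂ + 0 + 1) (solidOf (insert F T₂) ∪ B'.solid) := by
    refine LitWith.insert_guard heF ?_
    rw [Brick.openSegment_edge, empty_union]
    refine (HF.sideLit (.refl _ F) hF h.right.pair subset_rfl).union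
      (LitWith.of_chord_subset (b := !d) h.right.pair hB'
        (fun b ↦ (F.orient_mul_side_le i (!c) b).trans (h.right.support_le h.right.pair.left b))
        (Brick.chord_subset_chord (fun b ↦ (h.right.across b).ge)
          (Brick.side_eq_side_not_iff.2 (by rw [add_comm]; exact h.right_height))))
  refine (near.union far).mono subset_rfl (by omega) ?_
  rw [solidOf_insert B', solidOf_union]
  exact union_subset (subset_union_left.trans subset_union_left)
    (union_subset (subset_union_right.trans subset_union_right)
      (union_subset_union subset_union_right subset_union_left))

theorem DoubleCastleOn.litWith (H : DoubleCastleOn D E d i j c B T k B' T' k') :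
    LitWith D E ∅ (k + k' + 1) (solidOf (insert B T) ∪ solidOf (insert B' T')) := by
  induction hn : k + k' using Nat.strong_induction_on generalizing d B T k B' T' k' with
  | _ n ih =>
    subst hn
    obtain ⟨-, wide, -, hD', -⟩ := id H
    cases wide with
    | leaf =>
      refine H.litWith_of_wide fun L hL ↦ ?_
      rw [solidOf_insert_empty] at hD' ⊢
      exact LitWith.of_chord_subset H.pushedIn.pair hD' H.orient_mul_side_le hL
    | @node _ B₁ B₂ T₁ T₂ k₁ k₂ i₀ j₀ c₀ h he₁ he₂ H₁ H₂ =>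
      rcases H.pushedIn.pair.eq_or_eq_swap h.left.pair with ⟨rfl, rfl⟩ | ⟨rfl, rfl⟩
      · obtain rfl | rfl := Bool.eq_or_eq_not c c₀
        · exact H.litWith_of_parallel h he₁ he₂ H₁ H₂
            fun _ _ _ _ _ _ _ hm H ↦ ih _ (by omega) H rfl
        · rw [union_comm (insert B₁ T₁), add_comm k₁] at H ⊢
          rw [← Bool.not_not c₀] at he₁
          exact H.litWith_of_parallel h.symm he₂ he₁ H₂ H₁
            fun _ _ _ _ _ _ _ hm H ↦ ih _ (by omega) H rfl
      · refine H.litWith_of_wide fun L hL ↦ ?_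
        simp only [solidOf_insert B', solidOf_union, union_subset_iff] at hD' ⊢
        obtain ⟨hB', hD₁, hD₂⟩ := hD'
        have root : LitWith D E L 0 B'.solid :=
          LitWith.of_chord_subset H.pushedIn.pair hB' H.orient_mul_side_le hL
        have lit₁ := H₁.crossLit.child h hB' hD₁ he₁ H.orient_mul_side_le hL
        have lit₂ := H₂.crossLit.child h.symm hB' hD₂ he₂ H.orient_mul_side_le hL
        exact (root.union (lit₁.union lit₂)).mono subset_rfl (by omega) subset_rfl

end DoubleCastles

section Cones

/-- `B` is attached to the horizontal face of `A` on the side `d`, in a non-degenerate rectangle. -/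
def Brick.AttachedAt (A B : Brick) (d : Bool) : Prop :=
  A.support 2 d + B.support 2 (!d) = 0 ∧ ∀ n, n ≠ 2 → ∀ b, 0 < A.support n b + B.support n (!b)

/-- `N` is attached to the face of `W` on the side `d` through a primitive contact rectangle: it is
pushed strictly inwards on the side `c` in direction `i`. The reflex edge at that contact rectangle
is `N.edge i j c (!d)`. -/
structure ReflexContact (W N : Brick) (d : Bool) (i j : Fin 3) (c : Bool) : Prop where
  attachedAt : W.AttachedAt N d
  pushedIn : N.PushedIn W i j c
  strict : N.support i c < W.support i c

/-- The bricks in the finite collection `Q` are disjoint or touch in a primitive contact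
rectangle. -/
structure PrimitiveFamily (Q : Set Brick) : Prop where
  finite : Q.Finite
  touch : ∀ A ∈ Q, ∀ B ∈ Q, A ≠ B → Disjoint A.solid B.solid ∨ ∃ d, A.AttachedAt B d
  primitive : ∀ A ∈ Q, ∀ B ∈ Q, ∀ d, A.AttachedAt B d →
    ∃ i j c, ReflexContact A B d i j c ∨ ReflexContact B A (!d) i j c

/-- The tangent cone of the brick `B` at a point `p` of `B`. -/
def Brick.cone (B : Brick) (p : Pt) : Set Pt :=
  {u | ∀ n b, orient b * p n = B.support n b → orient b * u n ≤ 0}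

/-- The tangent cone at `p` of the union of the bricks in `Q`. -/
def coneOf (Q : Set Brick) (p : Pt) : Set Pt := {u | ∃ B ∈ Q, p ∈ B.solid ∧ u ∈ B.cone p}

/-- The tangent cone of a solid at a reflex point in direction `k`: the complement of an open
quadrant, given by the signs of `σ`, times a line in direction `k`. -/
def reflexCone (σ : Fin 3 → ℝ) (k : Fin 3) : Set Pt := {u | ∃ n, n ≠ k ∧ σ n * u n ≤ 0}

variable {A B : Brick} {Q : Set Brick} {p u : Pt} {k n : Fin 3} {b c d : Bool}
  {σ : Fin 3 → ℝ} {t : ℝ}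

theorem Brick.AttachedAt.symm (h : A.AttachedAt B d) : B.AttachedAt A (!d) := by
  refine ⟨by rw [Bool.not_not, add_comm]; exact h.1, fun n hn b ↦ ?_⟩
  have := h.2 n hn (!b)
  rwa [Bool.not_not, add_comm] at this

theorem Brick.AttachedAt.orient_mul_eq (h : A.AttachedAt B d) (hA : p ∈ A.solid)
    (hB : p ∈ B.solid) : orient d * p 2 = A.support 2 d := by
  have hA := mem_solid_iff.1 hA 2 d
  have hB := mem_solid_iff.1 hB 2 (!d)
  rw [orient_not] at hB
  linarith [h.1]

theorem Brick.orient_mul_lt_of_eq_not (h : orient (!b) * p n = B.support n (!b)) :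
    orient b * p n < B.support n b := by
  have := B.support_add_support_not_pos n b
  rw [orient_not] at h
  linarith

theorem Brick.eq_of_orient_mul_eq (h : orient b * p n = B.support n b)
    (h' : orient c * p n = B.support n c) : b = c := by
  obtain hbc | rfl := Bool.eq_or_eq_not b c
  · exact hbc
  · exact absurd h' (orient_mul_lt_of_eq_not h).ne

theorem Brick.orient_mul_lt_of_eq (h : orient b * p n = B.support n b) :
    orient (!b) * p n < B.support n (!b) :=
  orient_mul_lt_of_eq_not (by rwa [Bool.not_not])

theorem PrimitiveFamily.exists_attachedAt (hQ : PrimitiveFamily Q) (hA : A ∈ Q) (hB : B ∈ Q)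
    (hAB : A ≠ B) (hpA : p ∈ A.solid) (hpB : p ∈ B.solid) : ∃ d, A.AttachedAt B d :=
  (hQ.touch A hA B hB hAB).resolve_left fun h ↦ disjoint_left.1 h hpA hpB

theorem PrimitiveFamily.eq_or_eq_of_mem {C : Brick} (hQ : PrimitiveFamily Q) (hA : A ∈ Q)
    (hB : B ∈ Q) (hC : C ∈ Q) (hAB : A ≠ B) (hpA : p ∈ A.solid) (hpB : p ∈ B.solid)
    (hpC : p ∈ C.solid) : C = A ∨ C = B := by
  by_contra! hne
  obtain ⟨d, hd⟩ := hQ.exists_attachedAt hA hB hAB hpA hpB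
  obtain ⟨a, ha⟩ := hQ.exists_attachedAt hC hA hne.1 hpC hpA
  obtain ⟨b, hb⟩ := hQ.exists_attachedAt hC hB hne.2 hpC hpB
  have hAd := hd.orient_mul_eq hpA hpB
  have hBd := hd.symm.orient_mul_eq hpB hpA
  have hAa := ha.symm.orient_mul_eq hpA hpC
  have hBb := hb.symm.orient_mul_eq hpB hpC
  have hCa := ha.orient_mul_eq hpC hpA
  have hCb := hb.orient_mul_eq hpC hpB
  have hda : d = !a := Brick.eq_of_orient_mul_eq hAd hAa
  have hdb : (!d) = !b := Brick.eq_of_orient_mul_eq hBd hBb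
  have hab : a = b := Brick.eq_of_orient_mul_eq hCa hCb
  rw [hab, ← hdb] at hda
  exact Bool.not_ne_self d hda.symm

theorem PrimitiveFamily.coneOf_eq (hQ : PrimitiveFamily Q) (hA : A ∈ Q) (hB : B ∈ Q) (hAB : A ≠ B)
    (hpA : p ∈ A.solid) (hpB : p ∈ B.solid) : coneOf Q p = A.cone p ∪ B.cone p := by
  ext u
  constructor
  · rintro ⟨C, hC, hpC, hu⟩
    rcases hQ.eq_or_eq_of_mem hA hB hC hAB hpA hpB hpC with rfl | rfl
    · exact Or.inl hu
    · exact Or.inr hu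
  · rintro (hu | hu)
    · exact ⟨A, hA, hpA, hu⟩
    · exact ⟨B, hB, hpB, hu⟩

theorem Brick.eventually_mem_solid_iff (B : Brick) (p : Pt) :
    ∀ᶠ q in 𝓝 p, (q ∈ B.solid ↔ p ∈ B.solid ∧ q - p ∈ B.cone p) := by
  by_cases hp : p ∈ B.solid
  · have hface (n : Fin 3) (b : Bool) : ∀ᶠ q : Pt in 𝓝 p, (orient b * q n ≤ B.support n b ↔
        (orient b * p n = B.support n b → orient b * (q n - p n) ≤ 0)) := by
      rcases (mem_solid_iff.1 hp n b).eq_or_lt with heq | hlt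
      · filter_upwards with q
        simp only [← heq, mul_sub, sub_nonpos, true_imp_iff]
      · have hcont : Continuous fun q : Pt ↦ orient b * q n := by fun_prop
        filter_upwards [hcont.continuousAt.eventually_lt continuousAt_const hlt] with q hq
        simp only [hq.le, hlt.ne, false_imp_iff]
    filter_upwards [eventually_all.2 fun n ↦ eventually_all.2 (hface n)] with q hq
    simp only [mem_solid_iff (p := q), hq, hp, true_and, cone, mem_ofPred_eq, Pi.sub_apply]
  · filter_upwards [isClosed_Icc.isOpen_compl.mem_nhds hp] with q hq
    simp only [hp, false_and, iff_false]
    exact hq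

theorem eventually_mem_solidOf_iff (hQ : Q.Finite) (p : Pt) :
    ∀ᶠ q in 𝓝 p, (q ∈ solidOf Q ↔ q - p ∈ coneOf Q p) := by
  filter_upwards [(eventually_all_finite hQ).2 fun B _ ↦ B.eventually_mem_solid_iff p] with q hq
  simp only [mem_solidOf, coneOf, mem_ofPred_eq]
  exact exists_congr fun B ↦ and_congr_right (hq B)

theorem eventually_sub_mem_iff {C C' : Set Pt} (hC : ∀ u, ∀ t > (0 : ℝ), t • u ∈ C ↔ u ∈ C)
    (hC' : ∀ u, ∀ t > (0 : ℝ), t • u ∈ C' ↔ u ∈ C') :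
    (∀ᶠ q in 𝓝 p, (q - p ∈ C ↔ q - p ∈ C')) ↔ C = C' := by
  refine ⟨fun h ↦ ?_, fun h ↦ by simp [h]⟩
  ext u
  have hcont : ContinuousAt (fun t : ℝ ↦ p + t • u) 0 := by fun_prop
  have hlim : Tendsto (fun t : ℝ ↦ p + t • u) (𝓝[>] 0) (𝓝 p) := by
    simpa using hcont.tendsto.mono_left nhdsWithin_le_nhds
  obtain ⟨t, hmem, ht⟩ := ((hlim.eventually h).and self_mem_nhdsWithin).exists
  rwa [add_sub_cancel_left, hC u t ht, hC' u t ht] at hmem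

theorem mul_mul_nonpos_iff {s x : ℝ} (ht : 0 < t) : s * (t * x) ≤ 0 ↔ s * x ≤ 0 := by
  rw [mul_left_comm, ← not_lt, mul_pos_iff_of_pos_left ht, not_lt]

theorem smul_mem_coneOf_iff (ht : 0 < t) : t • u ∈ coneOf Q p ↔ u ∈ coneOf Q p := by
  simp only [coneOf, Brick.cone, mem_ofPred_eq, Pi.smul_apply, smul_eq_mul, mul_mul_nonpos_iff ht]

theorem smul_mem_reflexCone_iff (ht : 0 < t) : t • u ∈ reflexCone σ k ↔ u ∈ reflexCone σ k := by
  simp only [reflexCone, mem_ofPred_eq, Pi.smul_apply, smul_eq_mul, mul_mul_nonpos_iff ht]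

theorem isReflexPoint_solidOf_iff (hQ : Q.Finite) :
    IsReflexPoint (solidOf Q) k p ↔ ∃ σ : Fin 3 → ℝ, (∀ n, σ n ≠ 0) ∧
      coneOf Q p = reflexCone σ k := by
  refine exists_congr fun σ ↦ and_congr_right fun _ ↦ ?_
  rw [← eventually_sub_mem_iff (p := p) (fun _ _ ↦ smul_mem_coneOf_iff)
    fun _ _ ↦ smul_mem_reflexCone_iff]
  refine eventually_congr ((eventually_mem_solidOf_iff hQ p).mono fun q hq ↦ ?_)
  rw [hq]
  rfl

end Cones

section ReflexPoints

variable {A B N W : Brick} {Q : Set Brick} {p u : Pt} {i j k n : Fin 3} {b c d : Bool}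
  {σ : Fin 3 → ℝ} {v : ℝ}

theorem not_reflexCone_subset (σ : Fin 3 → ℝ) (k n : Fin 3) (b : Bool) :
    ¬ reflexCone σ k ⊆ {u | orient b * u n ≤ 0} := by
  intro h
  obtain ⟨m, hmk, hmn⟩ := (by decide : ∀ k n : Fin 3, ∃ m, m ≠ k ∧ m ≠ n) k n
  have := h (show Pi.single n (orient b) ∈ reflexCone σ k from ⟨m, hmk, by simp [hmn]⟩)
  rw [mem_ofPred_eq, Pi.single_eq_same, orient_mul_orient] at this
  linarith

theorem self_notMem_reflexCone (hσ : ∀ n, σ n ≠ 0) : σ ∉ reflexCone σ k := by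
  rintro ⟨n, -, hn⟩
  exact hn.not_gt (mul_self_pos.2 (hσ n))

theorem update_mem_reflexCone (hn : n ≠ k) : Function.update σ n 0 ∈ reflexCone σ k :=
  ⟨n, hn, by simp⟩

theorem PrimitiveFamily.not_isReflexPoint_of_common_face (hQ : PrimitiveFamily Q) (hA : A ∈ Q)
    (hB : B ∈ Q) (hAB : A ≠ B) (hpA : p ∈ A.solid) (hpB : p ∈ B.solid)
    (hfA : orient b * p n = A.support n b) (hfB : orient b * p n = B.support n b) :
    ¬ IsReflexPoint (solidOf Q) k p := by
  rw [isReflexPoint_solidOf_iff hQ.finite]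
  rintro ⟨σ, -, hσ⟩
  refine not_reflexCone_subset σ k n b (hσ ▸ ?_)
  rw [hQ.coneOf_eq hA hB hAB hpA hpB]
  exact union_subset (fun u hu ↦ hu n b hfA) fun u hu ↦ hu n b hfB

theorem ReflexContact.ne (h : ReflexContact W N d i j c) : W ≠ N := by
  rintro rfl
  exact h.strict.false

theorem ReflexContact.mem_solid (h : ReflexContact W N d i j c)
    (hp : p ∈ N.chord j (N.side i c) (!d)) : p ∈ N.solid ∧ p ∈ W.solid := by
  constructor
  · exact Brick.chord_subset_solid h.pushedIn.pair (N.orient_mul_side_le i c) hp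
  · refine Brick.chord_subset_solid (b := d) h.pushedIn.pair (fun b ↦ ?_)
      (Brick.chord_subset_chord (fun b ↦ (h.pushedIn.across b).le) ?_ hp)
    · exact (N.orient_mul_side_le i c b).trans (h.pushedIn.support_le h.pushedIn.pair.left b)
    · exact (Brick.side_eq_side_not_iff.2 h.attachedAt.1).symm

theorem HorizontalPair.eq_linePt (h : HorizontalPair i j) (p : Pt) :
    p = linePt j (p i) (p 2) (p j) := by
  ext n
  rcases h.eq_or_eq (n := n) with rfl | rfl | rfl
  · exact (h.linePt_left ..).symm
  · exact (linePt_self ..).symm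
  · exact (h.linePt_two ..).symm

theorem Brick.mem_chord_iff (h : HorizontalPair i j) : p ∈ B.chord j v b ↔
    p i = v ∧ p 2 = B.side 2 b ∧ ∀ a, orient a * p j < B.support j a := by
  have hj : (∀ a, orient a * p j < B.support j a) ↔ p j ∈ Ioo (B.lo j) (B.hi j) := by
    simp [Bool.forall_bool, support, side, orient]
  rw [hj]
  constructor
  · rintro ⟨t, ht, rfl⟩
    exact ⟨h.linePt_left .., h.linePt_two .., by rwa [linePt_self]⟩
  · rintro ⟨hi, h2, hj⟩
    exact ⟨p j, hj, by rw [← hi, ← h2, ← h.eq_linePt]⟩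

theorem ReflexContact.cone_narrow (h : ReflexContact W N d i j c)
    (hp : p ∈ N.chord j (N.side i c) (!d)) :
    N.cone p = {u | orient c * u i ≤ 0 ∧ orient (!d) * u 2 ≤ 0} := by
  have hij := h.pushedIn.pair
  obtain ⟨hi, h2, hj⟩ := (Brick.mem_chord_iff hij).1 hp
  have hi : orient c * p i = N.support i c := by rw [hi]; rfl
  have h2 : orient (!d) * p 2 = N.support 2 (!d) := by rw [h2]; rfl
  ext u
  refine ⟨fun hu ↦ ⟨hu i c hi, hu 2 (!d) h2⟩, fun hu n b hn ↦ ?_⟩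
  rcases hij.eq_or_eq (n := n) with rfl | rfl | rfl
  · rw [Brick.eq_of_orient_mul_eq hn hi]
    exact hu.1
  · exact absurd hn (hj b).ne
  · rw [Brick.eq_of_orient_mul_eq hn h2]
    exact hu.2

theorem Brick.mem_cone_of_ne_support (hne : ∀ n, n ≠ 2 → ∀ b, orient b * p n ≠ B.support n b)
    (h2 : orient d * p 2 = B.support 2 d) (hu : orient d * u 2 ≤ 0) : u ∈ B.cone p := by
  intro n b hn
  obtain rfl : n = 2 := not_imp_comm.1 (hne n · b) (not_not.2 hn)
  rwa [Brick.eq_of_orient_mul_eq hn h2]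

theorem ReflexContact.ne_support (h : ReflexContact W N d i j c) (hp : p ∈ N.solid)
    (hj : ∀ b, orient b * p j < N.support j b) (hi : orient (!c) * p i ≠ N.support i (!c)) :
    ∀ n, n ≠ 2 → ∀ b, orient b * p n ≠ W.support n b := by
  intro n hn b hW
  rcases h.pushedIn.pair.eq_or_eq (n := n) with rfl | rfl | rfl
  · obtain rfl | rfl := Bool.eq_or_eq_not b c
    · exact h.strict.not_ge (hW ▸ Brick.mem_solid_iff.1 hp n b)
    · exact hi (hW.trans h.pushedIn.flush.symm)
  · exact (hj b).ne (hW.trans (h.pushedIn.across b).symm)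
  · exact hn rfl

theorem ReflexContact.cone_wide (h : ReflexContact W N d i j c)
    (hp : p ∈ N.chord j (N.side i c) (!d)) : W.cone p = {u | orient d * u 2 ≤ 0} := by
  obtain ⟨hpN, hpW⟩ := h.mem_solid hp
  obtain ⟨hi, -, hj⟩ := (Brick.mem_chord_iff h.pushedIn.pair).1 hp
  have hi : orient c * p i = N.support i c := by rw [hi]; rfl
  have h2 := h.attachedAt.orient_mul_eq hpW hpN
  exact Subset.antisymm (fun u hu ↦ hu 2 d h2) fun u ↦ Brick.mem_cone_of_ne_support
    (h.ne_support hpN hj (Brick.orient_mul_lt_of_eq hi).ne) h2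

theorem PrimitiveFamily.isReflexPoint (hQ : PrimitiveFamily Q) (hW : W ∈ Q) (hN : N ∈ Q)
    (h : ReflexContact W N d i j c) (hp : p ∈ N.chord j (N.side i c) (!d)) :
    IsReflexPoint (solidOf Q) j p := by
  obtain ⟨hpN, hpW⟩ := h.mem_solid hp
  have hij := h.pushedIn.pair
  refine (isReflexPoint_solidOf_iff hQ.finite).2
    ⟨fun n ↦ if n = 2 then orient d else orient c, fun n ↦ ?_, ?_⟩
  · dsimp only
    split_ifs <;> exact orient_ne_zero _
  rw [hQ.coneOf_eq hW hN h.ne hpW hpN, h.cone_wide hp, h.cone_narrow hp]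
  ext u
  simp only [reflexCone, mem_union, mem_ofPred_eq]
  constructor
  · rintro (h2 | ⟨hi, -⟩)
    · exact ⟨2, hij.right.symm, by simpa using h2⟩
    · exact ⟨i, hij.ne, by simpa [hij.left] using hi⟩
  · rintro ⟨n, hnj, hn⟩
    rw [orient_not]
    rcases hij.eq_or_eq (n := n) with rfl | rfl | rfl
    · rw [if_neg hij.left] at hn
      rcases le_total (orient d * u 2) 0 with h2 | h2
      · exact Or.inl h2
      · exact Or.inr ⟨hn, by linarith⟩
    · exact absurd rfl hnj
    · exact Or.inl (by simpa using hn)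

theorem Brick.mem_cone_of_update {m : Fin 3} (hmn : m ≠ n)
    (hm : Function.update u m 0 ∈ B.cone p) (hn : Function.update u n 0 ∈ B.cone p) :
    u ∈ B.cone p := by
  intro l b hl
  by_cases hlm : l = m
  · subst hlm
    simpa [hmn] using hn l b hl
  · simpa [hlm] using hm l b hl

theorem exists_two_bricks_of_coneOf_eq (hσ : ∀ n, σ n ≠ 0) (h : coneOf Q p = reflexCone σ k) :
    ∃ A ∈ Q, ∃ B ∈ Q, A ≠ B ∧ p ∈ A.solid ∧ p ∈ B.solid := by
  obtain ⟨m, n, hmk, hnk, hmn⟩ :=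
    (by decide : ∀ k : Fin 3, ∃ m n : Fin 3, m ≠ k ∧ n ≠ k ∧ m ≠ n) k
  have hzero {n} (hn : n ≠ k) : Function.update σ n 0 ∈ coneOf Q p := h ▸ update_mem_reflexCone hn
  obtain ⟨A, hA, hpA, hm⟩ := hzero hmk
  obtain ⟨B, hB, hpB, hn⟩ := hzero hnk
  refine ⟨A, hA, B, hB, ?_, hpA, hpB⟩
  rintro rfl
  have hmem : σ ∈ coneOf Q p := ⟨A, hA, hpA, Brick.mem_cone_of_update hmn hm hn⟩
  exact self_notMem_reflexCone hσ (h ▸ hmem)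

theorem PrimitiveFamily.exists_reflexContact (hQ : PrimitiveFamily Q)
    (h : IsReflexPoint (solidOf Q) k p) :
    ∃ W ∈ Q, ∃ N ∈ Q, p ∈ W.solid ∧ p ∈ N.solid ∧ ∃ d i j c, ReflexContact W N d i j c := by
  obtain ⟨σ, hσ, hcone⟩ := (isReflexPoint_solidOf_iff hQ.finite).1 h
  obtain ⟨A, hA, B, hB, hAB, hpA, hpB⟩ := exists_two_bricks_of_coneOf_eq hσ hcone
  obtain ⟨d, hd⟩ := hQ.exists_attachedAt hA hB hAB hpA hpB
  obtain ⟨i, j, c, h | h⟩ := hQ.primitive A hA B hB d hd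
  · exact ⟨A, hA, B, hB, hpA, hpB, d, i, j, c, h⟩
  · exact ⟨B, hB, A, hA, hpB, hpA, !d, i, j, c, h⟩

theorem ReflexContact.mem_chord (h : ReflexContact W N d i j c) (hpW : p ∈ W.solid)
    (hpN : p ∈ N.solid)
    (hne : ∀ n b, orient b * p n = N.support n b → orient b * p n ≠ W.support n b)
    (hσ : σ ∉ W.cone p ∪ N.cone p) : p ∈ N.chord j (N.side i c) (!d) := by
  have hij := h.pushedIn.pair
  have hW2 := h.attachedAt.orient_mul_eq hpW hpN
  have hN2 := h.attachedAt.symm.orient_mul_eq hpN hpW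
  have hj (b : Bool) : orient b * p j < N.support j b :=
    (Brick.mem_solid_iff.1 hpN j b).lt_of_ne fun hb ↦ hne j b hb (hb.trans (h.pushedIn.across b))
  refine (Brick.mem_chord_iff hij).2 ⟨?_, orient_mul_cancel.1 hN2, hj⟩
  refine orient_mul_cancel.1 (show orient c * p i = N.support i c from ?_)
  by_contra hc
  have hi (b : Bool) : orient b * p i ≠ N.support i b := by
    obtain rfl | rfl := Bool.eq_or_eq_not b c
    · exact hc
    · exact fun hb ↦ hne i _ hb (hb.trans h.pushedIn.flush)
  have hN (n : Fin 3) (hn : n ≠ 2) (b : Bool) : orient b * p n ≠ N.support n b := by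
    rcases hij.eq_or_eq (n := n) with rfl | rfl | rfl
    · exact hi b
    · exact (hj b).ne
    · exact absurd rfl hn
  refine hσ ((le_total (orient d * σ 2) 0).imp
    (Brick.mem_cone_of_ne_support (h.ne_support hpN hj (hi _)) hW2) fun h2 ↦ ?_)
  refine Brick.mem_cone_of_ne_support hN hN2 ?_
  rw [orient_not]
  linarith

theorem ReflexContact.eq_of_union_cone_eq (h : ReflexContact W N d i j c)
    (hp : p ∈ N.chord j (N.side i c) (!d)) (hσ : ∀ n, σ n ≠ 0)
    (hcone : W.cone p ∪ N.cone p = reflexCone σ k) : k = j := by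
  have hij := h.pushedIn.pair
  by_contra hkj
  have hzero : Function.update σ j 0 ∈ reflexCone σ k := update_mem_reflexCone (Ne.symm hkj)
  refine self_notMem_reflexCone (k := k) hσ ?_
  rw [← hcone, h.cone_wide hp, h.cone_narrow hp] at hzero ⊢
  simpa [hij.ne, hij.right.symm] using hzero

theorem PrimitiveFamily.exists_mem_chord (hQ : PrimitiveFamily Q)
    (h : IsReflexPoint (solidOf Q) k p) : ∃ W ∈ Q, ∃ N ∈ Q, ∃ d i c,
      ReflexContact W N d i k c ∧ p ∈ N.chord k (N.side i c) (!d) := by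
  obtain ⟨W, hW, N, hN, hpW, hpN, d, i, j, c, hWN⟩ := hQ.exists_reflexContact h
  obtain ⟨σ, hσ, hcone⟩ := (isReflexPoint_solidOf_iff hQ.finite).1 h
  rw [hQ.coneOf_eq hW hN hWN.ne hpW hpN] at hcone
  have hp : p ∈ N.chord j (N.side i c) (!d) := hWN.mem_chord hpW hpN
    (fun n b hnN hnW ↦ hQ.not_isReflexPoint_of_common_face hW hN hWN.ne hpW hpN hnW hnN h)
    (hcone ▸ self_notMem_reflexCone hσ)
  obtain rfl := hWN.eq_of_union_cone_eq hp hσ hcone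
  exact ⟨W, hW, N, hN, d, i, c, hWN, hp⟩

end ReflexPoints

section ReflexEdges

/-- `e` is a reflex edge of `P` in direction `i`. -/
def IsReflexEdge (P : Set Pt) (i : Fin 3) (e : Pt × Pt) : Prop :=
  e.1 i < e.2 i ∧ (∀ j, j ≠ i → e.1 j = e.2 j) ∧
    (∀ p ∈ openSegment ℝ e.1 e.2, IsReflexPoint P i p) ∧
      ¬ IsReflexPoint P i e.1 ∧ ¬ IsReflexPoint P i e.2

/-- The reflex edges at the contact rectangles of the bricks in `Q`. -/
def contactEdges (Q : Set Brick) : Set (Pt × Pt) :=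
  {e | ∃ W ∈ Q, ∃ N ∈ Q, ∃ d i j c, ReflexContact W N d i j c ∧ e = N.edge i j c (!d)}

variable {W N : Brick} {Q : Set Brick} {P : Set Pt} {p : Pt} {i j k : Fin 3} {b c d : Bool}
  {e f : Pt × Pt} {v : ℝ}

theorem mem_reflexEdges : e ∈ reflexEdges P ↔ ∃ i, IsReflexEdge P i e := Iff.rfl

theorem IsReflexEdge.openSegment_eq (he : IsReflexEdge P i e) :
    openSegment ℝ e.1 e.2 = Function.update e.1 i '' Ioo (e.1 i) (e.2 i) := by
  have h2 : e.2 = Function.update e.1 i (e.2 i) :=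
    Function.eq_update_iff.2 ⟨rfl, fun j hj ↦ (he.2.1 j hj).symm⟩
  rw [← openSegment_eq_Ioo he.1, Pi.image_update_openSegment, Function.update_eq_self, ← h2]

theorem IsReflexEdge.mem_openSegment_iff (he : IsReflexEdge P i e) :
    p ∈ openSegment ℝ e.1 e.2 ↔ (e.1 i < p i ∧ p i < e.2 i) ∧ ∀ j, j ≠ i → p j = e.1 j := by
  rw [he.openSegment_eq]
  constructor
  · rintro ⟨t, ht, rfl⟩
    exact ⟨by rwa [Function.update_self], fun j hj ↦ Function.update_of_ne hj ..⟩
  · rintro ⟨hi, hj⟩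
    exact ⟨p i, hi, (Function.eq_update_iff.2 ⟨rfl, hj⟩).symm⟩

theorem IsReflexEdge.endpoints_le (he : IsReflexEdge P i e) (hf : IsReflexEdge P i f)
    (hpe : p ∈ openSegment ℝ e.1 e.2) (hpf : p ∈ openSegment ℝ f.1 f.2) :
    f.1 i ≤ e.1 i ∧ e.2 i ≤ f.2 i := by
  obtain ⟨⟨hl, hr⟩, hoff⟩ := hf.mem_openSegment_iff.1 hpf
  obtain ⟨⟨hle, hre⟩, hoffe⟩ := he.mem_openSegment_iff.1 hpe
  have hmem {q : Pt} (h1 : e.1 i < q i) (h2 : q i < e.2 i) (hq : ∀ j, j ≠ i → q j = f.1 j) :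
      IsReflexPoint P i q := he.2.2.1 q <| he.mem_openSegment_iff.2
    ⟨⟨h1, h2⟩, fun j hj ↦ by rw [hq j hj, ← hoff j hj, hoffe j hj]⟩
  constructor
  · by_contra! h
    exact hf.2.2.2.1 (hmem h (hl.trans hre) fun _ _ ↦ rfl)
  · by_contra! h
    exact hf.2.2.2.2 (hmem (hle.trans hr) h fun j hj ↦ (hf.2.1 j hj).symm)

theorem IsReflexEdge.eq_of_mem (he : IsReflexEdge P i e) (hf : IsReflexEdge P i f)
    (hpe : p ∈ openSegment ℝ e.1 e.2) (hpf : p ∈ openSegment ℝ f.1 f.2) : e = f := by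
  obtain ⟨hl, hr⟩ := he.endpoints_le hf hpe hpf
  obtain ⟨hl', hr'⟩ := hf.endpoints_le he hpf hpe
  have hoff (j : Fin 3) (hj : j ≠ i) : e.1 j = f.1 j :=
    ((he.mem_openSegment_iff.1 hpe).2 j hj).symm.trans ((hf.mem_openSegment_iff.1 hpf).2 j hj)
  refine Prod.ext (funext fun j ↦ ?_) (funext fun j ↦ ?_) <;> obtain rfl | hj := eq_or_ne j i
  · exact hl'.antisymm hl
  · exact hoff j hj
  · exact hr.antisymm hr'
  · rw [← he.2.1 j hj, ← hf.2.1 j hj, hoff j hj]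

theorem Brick.linePt_side_mem_solid {B : Brick} (h : HorizontalPair i j)
    (hv : ∀ a, orient a * v ≤ B.support i a) (b c : Bool) :
    linePt j v (B.side 2 b) (B.side j c) ∈ B.solid := by
  refine mem_solid_iff.2 fun n a ↦ ?_
  rcases h.eq_or_eq (n := n) with rfl | rfl | rfl
  · rw [h.linePt_left]
    exact hv a
  · rw [linePt_self]
    exact B.orient_mul_side_le ..
  · rw [h.linePt_two]
    exact B.orient_mul_side_le ..

theorem PrimitiveFamily.not_isReflexPoint_edge (hQ : PrimitiveFamily Q) (hW : W ∈ Q) (hN : N ∈ Q)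
    (h : ReflexContact W N d i j c) (b : Bool) :
    ¬ IsReflexPoint (solidOf Q) k
      (linePt j (N.side i c) (N.side 2 (!d)) (N.side j b)) := by
  have hij := h.pushedIn.pair
  have hjW : W.side j b = N.side j b := Brick.side_eq_side_iff.2 (h.pushedIn.across b).symm
  have h2W : W.side 2 d = N.side 2 (!d) := Brick.side_eq_side_not_iff.2 h.attachedAt.1
  have hmemN := Brick.linePt_side_mem_solid hij (N.orient_mul_side_le i c) (!d) b
  have hmemW := Brick.linePt_side_mem_solid (B := W) hij (fun a ↦
    (N.orient_mul_side_le i c a).trans (h.pushedIn.support_le hij.left a)) d b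
  rw [hjW, h2W] at hmemW
  refine hQ.not_isReflexPoint_of_common_face (n := j) (b := b) hW hN h.ne hmemW hmemN ?_ ?_
  · rw [linePt_self, ← hjW]
    rfl
  · rw [linePt_self]
    rfl

theorem PrimitiveFamily.isReflexEdge (hQ : PrimitiveFamily Q) (hW : W ∈ Q) (hN : N ∈ Q)
    (h : ReflexContact W N d i j c) : IsReflexEdge (solidOf Q) j (N.edge i j c (!d)) := by
  refine ⟨?_, fun n hn ↦ ?_, fun p hp ↦ ?_, hQ.not_isReflexPoint_edge hW hN h false,
    hQ.not_isReflexPoint_edge hW hN h true⟩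
  · simpa only [Brick.edge, linePt_self] using N.lo_lt_hi j
  · simp [Brick.edge, linePt, hn]
  · rw [Brick.openSegment_edge] at hp
    exact hQ.isReflexPoint hW hN h hp

theorem PrimitiveFamily.reflexEdges_eq (hQ : PrimitiveFamily Q) :
    reflexEdges (solidOf Q) = contactEdges Q := by
  ext e
  rw [mem_reflexEdges]
  constructor
  · rintro ⟨k, he⟩
    obtain ⟨p, hp⟩ : (openSegment ℝ e.1 e.2).Nonempty := by
      rw [he.openSegment_eq]
      exact (nonempty_Ioo.2 he.1).image _
    obtain ⟨W, hW, N, hN, d, i, c, h, hpN⟩ := hQ.exists_mem_chord (he.2.2.1 p hp)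
    rw [← Brick.openSegment_edge] at hpN
    exact ⟨W, hW, N, hN, d, i, k, c, h, he.eq_of_mem (hQ.isReflexEdge hW hN h) hp hpN⟩
  · rintro ⟨W, hW, N, hN, d, i, j, c, h, rfl⟩
    exact ⟨j, hQ.isReflexEdge hW hN h⟩

end ReflexEdges

section Contacts

/-- The pairs of bricks in `Q` of which the second one is attached to the first one on the
side `d`. -/
def contacts (d : Bool) (Q : Set Brick) : Set (Brick × Brick) :=
  {x | x.1 ∈ Q ∧ x.2 ∈ Q ∧ x.1.AttachedAt x.2 d}

variable {A B N W : Brick} {Q : Set Brick} {p : Pt} {i j i' j' : Fin 3} {c c' d d' : Bool}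
  {e : Pt × Pt}

theorem Brick.AttachedAt.ne (h : A.AttachedAt B d) : A ≠ B := by
  rintro rfl
  exact (A.support_add_support_not_pos 2 d).ne' h.1

theorem Brick.AttachedAt.dir_eq (h : A.AttachedAt B d) (h' : A.AttachedAt B d') : d = d' := by
  obtain hd | rfl := Bool.eq_or_eq_not d d'
  · exact hd
  · have h1 := h.1
    rw [Bool.not_not] at h1
    linarith [h'.1, A.support_add_support_not_pos 2 d', B.support_add_support_not_pos 2 d']

theorem ReflexContact.unique (h : ReflexContact W N d i j c) (h' : ReflexContact W N d' i' j' c') :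
    d = d' ∧ i = i' ∧ j = j' ∧ c = c' := by
  obtain ⟨rfl, rfl⟩ | ⟨rfl, rfl⟩ := h.pushedIn.pair.eq_or_eq_swap h'.pushedIn.pair
  · refine ⟨h.attachedAt.dir_eq h'.attachedAt, rfl, rfl, ?_⟩
    obtain hc | rfl := Bool.eq_or_eq_not c c'
    · exact hc
    · exact absurd h'.pushedIn.flush h.strict.ne
  · exact absurd (h'.pushedIn.across c) h.strict.ne

theorem ReflexContact.not_symm (h : ReflexContact W N d i j c) :
    ¬ ReflexContact N W d' i' j' c' := fun h' ↦
  h.strict.not_ge (h'.pushedIn.support_le h.pushedIn.pair.left c)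

/-- `e` is the reflex edge at the contact rectangle of `B` with the face of `A` on the side `d`. -/
def IsContactEdge (A B : Brick) (d : Bool) (e : Pt × Pt) : Prop :=
  ∃ i j c, (ReflexContact A B d i j c ∧ e = B.edge i j c (!d)) ∨
    (ReflexContact B A (!d) i j c ∧ e = A.edge i j c d)

theorem IsContactEdge.symm (h : IsContactEdge A B d e) : IsContactEdge B A (!d) e := by
  obtain ⟨i, j, c, h | h⟩ := h
  · exact ⟨i, j, c, .inr (by rwa [Bool.not_not])⟩
  · exact ⟨i, j, c, .inl (by rwa [Bool.not_not])⟩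

theorem IsContactEdge.unique {e e' : Pt × Pt} (h : IsContactEdge A B d e)
    (h' : IsContactEdge A B d e') : e = e' := by
  obtain ⟨i, j, c, ⟨h, rfl⟩ | ⟨h, rfl⟩⟩ := h <;> obtain ⟨i', j', c', ⟨h', rfl⟩ | ⟨h', rfl⟩⟩ := h'
  · obtain ⟨-, rfl, rfl, rfl⟩ := h.unique h'
    rfl
  · exact absurd h' h.not_symm
  · exact absurd h' h.not_symm
  · obtain ⟨-, rfl, rfl, rfl⟩ := h.unique h'
    rfl

theorem IsContactEdge.openSegment_subset (h : IsContactEdge A B d e) :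
    openSegment ℝ e.1 e.2 ⊆ A.solid ∩ B.solid := by
  obtain ⟨i, j, c, ⟨h, rfl⟩ | ⟨h, rfl⟩⟩ := h
  · rw [Brick.openSegment_edge]
    exact fun p hp ↦ (h.mem_solid hp).symm
  · rw [Brick.openSegment_edge, ← Bool.not_not d]
    exact fun p hp ↦ h.mem_solid hp

theorem PrimitiveFamily.attachedAt_unique {A' B' : Brick} (hQ : PrimitiveFamily Q) (hA : A ∈ Q)
    (hB : B ∈ Q) (hA' : A' ∈ Q) (hB' : B' ∈ Q) (hpA : p ∈ A.solid) (hpB : p ∈ B.solid)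
    (hpA' : p ∈ A'.solid) (hpB' : p ∈ B'.solid) (h : A.AttachedAt B d) (h' : A'.AttachedAt B' d) :
    A = A' ∧ B = B' := by
  rcases hQ.eq_or_eq_of_mem hA hB hA' h.ne hpA hpB hpA' with rfl | rfl <;>
    rcases hQ.eq_or_eq_of_mem hA hB hB' h.ne hpA hpB hpB' with rfl | rfl
  · exact absurd rfl h'.ne
  · exact ⟨rfl, rfl⟩
  · exact absurd (h.symm.dir_eq h') (Bool.not_ne_self d)
  · exact absurd rfl h'.ne

theorem PrimitiveFamily.bijOn {f : Brick × Brick → Pt × Pt} (hQ : PrimitiveFamily Q)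
    (hf : ∀ x ∈ contacts d Q, IsContactEdge x.1 x.2 d (f x)) :
    BijOn f (contacts d Q) (contactEdges Q) := by
  refine ⟨?_, ?_, ?_⟩
  · rintro ⟨A, B⟩ hx
    obtain ⟨i, j, c, ⟨h, he⟩ | ⟨h, he⟩⟩ := hf _ hx
    · exact ⟨A, hx.1, B, hx.2.1, d, i, j, c, h, he⟩
    · exact ⟨B, hx.2.1, A, hx.1, !d, i, j, c, h, by rwa [Bool.not_not]⟩
  · rintro ⟨A, B⟩ hx ⟨A', B'⟩ hx' heq
    obtain ⟨p, hp⟩ : (openSegment ℝ (f (A, B)).1 (f (A, B)).2).Nonempty := by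
      rw [openSegment_eq_image]
      exact (nonempty_Ioo.2 one_pos).image _
    obtain ⟨hpA, hpB⟩ := (hf _ hx).openSegment_subset hp
    obtain ⟨hpA', hpB'⟩ := (hf _ hx').openSegment_subset (heq ▸ hp)
    obtain ⟨rfl, rfl⟩ := hQ.attachedAt_unique hx.1 hx.2.1 hx'.1 hx'.2.1 hpA hpB hpA' hpB'
      hx.2.2 hx'.2.2
    rfl
  · rintro e ⟨W, hW, N, hN, d', i, j, c, h, rfl⟩
    have he : IsContactEdge W N d' (N.edge i j c (!d')) := ⟨i, j, c, .inl ⟨h, rfl⟩⟩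
    obtain rfl | rfl := Bool.eq_or_eq_not d' d
    · have hx : (W, N) ∈ contacts d' Q := ⟨hW, hN, h.attachedAt⟩
      exact ⟨_, hx, (hf _ hx).unique he⟩
    · have hx : (N, W) ∈ contacts d Q := ⟨hN, hW, by simpa using h.attachedAt.symm⟩
      exact ⟨_, hx, (hf _ hx).unique (by simpa using he.symm)⟩

theorem PrimitiveFamily.exists_bijOn (hQ : PrimitiveFamily Q) (d : Bool) :
    ∃ f : Brick × Brick → Pt × Pt, BijOn f (contacts d Q) (contactEdges Q) := by
  have hex (x : Brick × Brick) (hx : x ∈ contacts d Q) : ∃ e, IsContactEdge x.1 x.2 d e := by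
    obtain ⟨i, j, c, h | h⟩ := hQ.primitive _ hx.1 _ hx.2.1 _ hx.2.2
    · exact ⟨_, i, j, c, .inl ⟨h, rfl⟩⟩
    · exact ⟨_, i, j, c, .inr ⟨h, rfl⟩⟩
  choose! f hf using hex
  exact ⟨f, hQ.bijOn hf⟩

theorem PrimitiveFamily.finite_contacts (hQ : PrimitiveFamily Q) (d : Bool) :
    (contacts d Q).Finite :=
  (hQ.finite.prod hQ.finite).subset fun _ hx ↦ ⟨hx.1, hx.2.1⟩

theorem PrimitiveFamily.finite_contactEdges (hQ : PrimitiveFamily Q) : (contactEdges Q).Finite := by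
  obtain ⟨f, hf⟩ := hQ.exists_bijOn true
  exact hf.image_eq ▸ (hQ.finite_contacts true).image f

theorem PrimitiveFamily.ncard_contactEdges (hQ : PrimitiveFamily Q) (d : Bool) :
    (contactEdges Q).ncard = (contacts d Q).ncard := by
  obtain ⟨f, hf⟩ := hQ.exists_bijOn d
  rw [← hf.image_eq, hf.injOn.ncard_image]

theorem ncard_contacts_not (d : Bool) (Q : Set Brick) :
    (contacts (!d) Q).ncard = (contacts d Q).ncard := by
  have : contacts (!d) Q = Prod.swap '' contacts d Q := by
    ext ⟨A, B⟩
    simp only [image_swap_eq_preimage_swap, mem_preimage, Prod.swap_prod_mk, contacts,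
      mem_ofPred_eq]
    constructor
    · rintro ⟨hA, hB, h⟩
      exact ⟨hB, hA, by simpa using h.symm⟩
    · rintro ⟨hB, hA, h⟩
      exact ⟨hA, hB, h.symm⟩
  rw [this, ncard_image_of_injective _ Prod.swap_injective]

end Contacts

/-- `Q` is the collection of bricks of a castle which grows in the vertical direction `d` from its
base brick `B₀`. -/
structure CastleFamily (d : Bool) (Q : Set Brick) (B₀ : Brick) : Prop where
  primitiveFamily : PrimitiveFamily Q
  isConnected : IsConnected (solidOf Q)
  zero_or_two : ∀ A ∈ Q, {B ∈ Q | A.AttachedAt B d}.ncard = 0 ∨ {B ∈ Q | A.AttachedAt B d}.ncard = 2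
  base_mem : B₀ ∈ Q
  base : ∀ A ∈ Q, A.support 2 (!d) ≤ B₀.support 2 (!d)

section Children

variable {A B B₀ B₁ B₂ N : Brick} {Q : Set Brick} {i j : Fin 3} {b c d : Bool}

theorem PrimitiveFamily.exists_support_add_neg (hQ : PrimitiveFamily Q) (hA : A ∈ Q) (hB : B ∈ Q)
    (hAB : A ≠ B) (h2 : A.support 2 b = B.support 2 b) :
    ∃ n, n ≠ 2 ∧ ∃ a, A.support n a + B.support n (!a) < 0 := by
  have hpos (a : Bool) : 0 < A.support 2 a + B.support 2 (!a) := by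
    obtain rfl | rfl := Bool.eq_or_eq_not a b
    · rw [h2]
      exact B.support_add_support_not_pos 2 a
    · rw [Bool.not_not, ← h2, add_comm]
      exact A.support_add_support_not_pos 2 b
  rcases hQ.touch A hA B hB hAB with hdisj | ⟨d, hd⟩
  · obtain ⟨n, a, ha⟩ := Brick.exists_support_add_neg_of_disjoint hdisj
    refine ⟨n, ?_, a, ha⟩
    rintro rfl
    exact ha.not_gt (hpos a)
  · exact absurd hd.1 (hpos d).ne'

theorem PrimitiveFamily.exists_reflexContact_of_sibling (hQ : PrimitiveFamily Q) (hA : A ∈ Q)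
    (h₁ : B₁ ∈ Q) (h₂ : B₂ ∈ Q) (hne : B₁ ≠ B₂) (hd₁ : A.AttachedAt B₁ d)
    (hd₂ : A.AttachedAt B₂ d) : ∃ i j c, ReflexContact A B₁ d i j c := by
  obtain ⟨i, j, c, h | h⟩ := hQ.primitive A hA B₁ h₁ d hd₁
  · exact ⟨i, j, c, h⟩
  · obtain ⟨n, hn, a, ha⟩ := hQ.exists_support_add_neg (b := !d) h₁ h₂ hne
      (by linarith [hd₁.1, hd₂.1])
    linarith [hd₂.2 n hn a, h.pushedIn.support_le hn a]

theorem Brick.PushedIn.eq_of_lt {n : Fin 3} (h : B.PushedIn A i j c) (hn : n ≠ 2)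
    (hlt : B.support n b < A.support n b) : n = i ∧ b = c := by
  rcases h.pair.eq_or_eq (n := n) with rfl | rfl | rfl
  · obtain rfl | rfl := Bool.eq_or_eq_not b c
    · exact ⟨rfl, rfl⟩
    · exact absurd h.flush hlt.ne
  · exact absurd (h.across b) hlt.ne
  · exact absurd rfl hn

theorem PrimitiveFamily.exists_branching (hQ : PrimitiveFamily Q) (hA : A ∈ Q)
    (h₁ : B₁ ∈ Q) (h₂ : B₂ ∈ Q) (hne : B₁ ≠ B₂) (hd₁ : A.AttachedAt B₁ d)
    (hd₂ : A.AttachedAt B₂ d) : ∃ i j c, Branching d i j c A B₁ B₂ ∧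
      B₁.edge i j c (!d) ∈ contactEdges Q ∧ B₂.edge i j (!c) (!d) ∈ contactEdges Q := by
  obtain ⟨i, j, c, hc₁⟩ := hQ.exists_reflexContact_of_sibling hA h₁ h₂ hne hd₁ hd₂
  obtain ⟨i', j', c', hc₂⟩ := hQ.exists_reflexContact_of_sibling hA h₂ h₁ hne.symm hd₂ hd₁
  have hheight : B₁.support 2 (!d) = B₂.support 2 (!d) := by linarith [hd₁.1, hd₂.1]
  obtain ⟨n, hn, a, ha⟩ := hQ.exists_support_add_neg h₁ h₂ hne hheight
  have hlt₁ : B₁.support n a < A.support n a := by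
    linarith [B₂.support_add_support_not_pos n a, hc₂.pushedIn.support_le hn a]
  have hlt₂ : B₂.support n (!a) < A.support n (!a) := by
    linarith [B₁.support_add_support_not_pos n a, hc₁.pushedIn.support_le hn (!a)]
  obtain ⟨rfl, rfl⟩ := hc₁.pushedIn.eq_of_lt hn hlt₁
  obtain ⟨rfl, rfl⟩ := hc₂.pushedIn.eq_of_lt hn hlt₂
  obtain rfl : j = j' := by
    rcases hc₁.pushedIn.pair.eq_or_eq_swap hc₂.pushedIn.pair with ⟨-, h⟩ | ⟨h, -⟩
    · exact h.symm
    · exact absurd h hc₁.pushedIn.pair.ne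
  have hbranch : Branching d n j a A B₁ B₂ :=
    ⟨hc₁.pushedIn, hc₂.pushedIn, by rw [add_comm, hd₁.1], by rw [add_comm, hd₂.1], ha⟩
  exact ⟨n, j, a, hbranch,
    ⟨A, hA, B₁, h₁, d, n, j, a, hc₁, rfl⟩, ⟨A, hA, B₂, h₂, d, n, j, !a, hc₂, rfl⟩⟩

theorem CastleFamily.children_eq (H : CastleFamily d Q B₀) (hA : A ∈ Q) :
    {B ∈ Q | A.AttachedAt B d} = ∅ ∨ ∃ B₁ B₂, B₁ ≠ B₂ ∧ {B ∈ Q | A.AttachedAt B d} = {B₁, B₂} :=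
  (H.zero_or_two A hA).imp
    (ncard_eq_zero (H.primitiveFamily.finite.subset (sep_subset _ _))).1 ncard_eq_two.1

theorem CastleFamily.exists_reflexContact (H : CastleFamily d Q B₀) (hA : A ∈ Q) (hB : B ∈ Q)
    (h : A.AttachedAt B d) : ∃ i j c, ReflexContact A B d i j c := by
  have hmem : B ∈ {B ∈ Q | A.AttachedAt B d} := ⟨hB, h⟩
  rcases H.children_eq hA with hempty | ⟨B₁, B₂, hne, heq⟩
  · exact absurd (hempty ▸ hmem) (notMem_empty B)
  · obtain ⟨h₁, hd₁⟩ : B₁ ∈ {B ∈ Q | A.AttachedAt B d} := heq ▸ mem_insert B₁ {B₂}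
    obtain ⟨h₂, hd₂⟩ : B₂ ∈ {B ∈ Q | A.AttachedAt B d} := heq ▸ mem_insert_of_mem B₁ rfl
    rcases heq ▸ hmem with rfl | rfl
    · exact H.primitiveFamily.exists_reflexContact_of_sibling hA h₁ h₂ hne hd₁ hd₂
    · exact H.primitiveFamily.exists_reflexContact_of_sibling hA h₂ h₁ hne.symm hd₂ hd₁

theorem CastleFamily.parent_unique (H : CastleFamily d Q B₀) (hA : A ∈ Q) (hB : B ∈ Q)
    (hN : N ∈ Q) (hAN : A.AttachedAt N d) (hBN : B.AttachedAt N d) : A = B := by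
  obtain ⟨i, j, c, hc⟩ := H.exists_reflexContact hA hN hAN
  obtain ⟨i', j', c', hc'⟩ := H.exists_reflexContact hB hN hBN
  by_contra hne
  obtain ⟨n, hn, a, ha⟩ := H.primitiveFamily.exists_support_add_neg (b := d) hA hB hne
    (by linarith [hAN.1, hBN.1])
  linarith [hc.pushedIn.support_le hn a, hc'.pushedIn.support_le hn (!a),
    N.support_add_support_not_pos n a]

end Children

section Tree

variable {A B B₀ B₁ B₂ C N : Brick} {Q T : Set Brick} {E : Set (Pt × Pt)} {i j n : Fin 3}
  {b c d : Bool} {k : ℕ}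

theorem Brick.PushedIn.attachedAt (h : N.PushedIn B i j c)
    (h2 : N.support 2 (!d) + B.support 2 d = 0) : B.AttachedAt N d :=
  ⟨by rw [add_comm, h2], fun _ hn b ↦ (N.support_add_support_not_pos _ b).trans_le
    (add_le_add_left (h.support_le hn b) _)⟩

theorem CastleOn.support_le (H : CastleOn E d B T k) (hC : C ∈ T) :
    (∀ n, n ≠ 2 → ∀ b, C.support n b ≤ B.support n b) ∧ C.support 2 (!d) + B.support 2 d ≤ 0 := by
  induction H with
  | leaf => exact absurd hC (notMem_empty C)
  | @node B B₁ B₂ _ _ _ _ i j c h _ _ _ _ ih₁ ih₂ =>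
    have hpos₁ := B₁.support_add_support_not_pos 2 d
    have hpos₂ := B₂.support_add_support_not_pos 2 d
    rcases hC with (rfl | hC) | (rfl | hC)
    · exact ⟨fun n hn b ↦ h.left.support_le hn b, h.left_height.le⟩
    · obtain ⟨hle, h2⟩ := ih₁ hC
      exact ⟨fun n hn b ↦ (hle n hn b).trans (h.left.support_le hn b), by linarith [h.left_height]⟩
    · exact ⟨fun n hn b ↦ h.right.support_le hn b, h.right_height.le⟩
    · obtain ⟨hle, h2⟩ := ih₂ hC
      exact ⟨fun n hn b ↦ (hle n hn b).trans (h.right.support_le hn b),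
        by linarith [h.right_height]⟩

theorem CastleOn.support_lt (H : CastleOn E d B T k) (hC : C ∈ T) :
    C.support 2 (!d) < B.support 2 (!d) := by
  linarith [(H.support_le hC).2, B.support_add_support_not_pos 2 d]

theorem CastleOn.exists_parent (H : CastleOn E d B T k) (hC : C ∈ T) :
    ∃ A ∈ insert B T, A.AttachedAt C d := by
  induction H with
  | leaf => exact absurd hC (notMem_empty C)
  | @node B B₁ B₂ T₁ T₂ _ _ i j c h _ _ _ _ ih₁ ih₂ =>
    rcases hC with (rfl | hC) | (rfl | hC)
    · exact ⟨B, mem_insert _ _, h.left.attachedAt h.left_height⟩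
    · obtain ⟨A, hA, hAC⟩ := ih₁ hC
      exact ⟨A, .inr (.inl hA), hAC⟩
    · exact ⟨B, mem_insert _ _, h.right.attachedAt h.right_height⟩
    · obtain ⟨A, hA, hAC⟩ := ih₂ hC
      exact ⟨A, .inr (.inr hA), hAC⟩

theorem CastleOn.support_le_of_mem_insert (H : CastleOn E d B T k) (hC : C ∈ insert B T)
    (hn : n ≠ 2) (b : Bool) : C.support n b ≤ B.support n b := by
  rcases hC with rfl | hC
  · exact le_rfl
  · exact (H.support_le hC).1 n hn b

theorem CastleOn.finite_and_ncard (H : CastleOn E d B T k) : T.Finite ∧ T.ncard = 2 * k := by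
  induction H with
  | leaf => exact ⟨finite_empty, ncard_empty _⟩
  | @node B B₁ B₂ T₁ T₂ k₁ k₂ i j c h _ _ H₁ H₂ ih₁ ih₂ =>
    have hdisj : Disjoint (insert B₁ T₁) (insert B₂ T₂) := disjoint_left.2 fun C h₁ h₂ ↦ by
      linarith [H₁.support_le_of_mem_insert h₁ h.left.pair.left c, h.gap,
        H₂.support_le_of_mem_insert h₂ h.left.pair.left (!c), C.support_add_support_not_pos i c]
    have hfin₁ := ih₁.1.insert B₁
    have hfin₂ := ih₂.1.insert B₂
    refine ⟨hfin₁.union hfin₂, ?_⟩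
    rw [ncard_union_eq hdisj hfin₁ hfin₂,
      ncard_insert_of_notMem (fun hB ↦ (H₁.support_lt hB).false) ih₁.1, ih₁.2,
      ncard_insert_of_notMem (fun hB ↦ (H₂.support_lt hB).false) ih₂.1, ih₂.2]
    ring

theorem CastleFamily.exists_castleOn_closed (H : CastleFamily d Q B₀) (hE : contactEdges Q ⊆ E)
    (hB : B ∈ Q) : ∃ T k, CastleOn E d B T k ∧ T ⊆ Q ∧
      ∀ A ∈ insert B T, ∀ C ∈ Q, A.AttachedAt C d → C ∈ T := by
  have hwf : Q.WellFoundedOn ((fun B ↦ B.support 2 (!d)) ⁻¹'o (· < ·)) :=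
    H.primitiveFamily.finite.wellFoundedOn
  apply hwf.induction hB
  intro B hB ih
  have hlt {C : Brick} (hC : B.AttachedAt C d) : C.support 2 (!d) < B.support 2 (!d) := by
    linarith [hC.1, B.support_add_support_not_pos 2 d]
  rcases H.children_eq hB with hempty | ⟨B₁, B₂, hne, heq⟩
  · refine ⟨∅, 0, .leaf B, empty_subset _, ?_⟩
    rintro _ (rfl | hA) C hC hd
    · exact hempty ▸ ⟨hC, hd⟩
    · exact absurd hA (notMem_empty _)
  obtain ⟨h₁, hd₁⟩ : B₁ ∈ {C ∈ Q | B.AttachedAt C d} := heq ▸ mem_insert B₁ {B₂}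
  obtain ⟨h₂, hd₂⟩ : B₂ ∈ {C ∈ Q | B.AttachedAt C d} := heq ▸ mem_insert_of_mem B₁ rfl
  obtain ⟨i, j, c, hbranch, he₁, he₂⟩ := H.primitiveFamily.exists_branching hB h₁ h₂ hne hd₁ hd₂
  obtain ⟨T₁, k₁, H₁, hT₁, hclosed₁⟩ := ih B₁ h₁ (hlt hd₁)
  obtain ⟨T₂, k₂, H₂, hT₂, hclosed₂⟩ := ih B₂ h₂ (hlt hd₂)
  refine ⟨_, _, .node hbranch (hE he₁) (hE he₂) H₁ H₂,
    union_subset (insert_subset h₁ hT₁) (insert_subset h₂ hT₂), ?_⟩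
  rintro A (rfl | hA | hA) C hC hd
  · have hmem : C ∈ {C ∈ Q | A.AttachedAt C d} := ⟨hC, hd⟩
    rcases heq ▸ hmem with rfl | rfl
    · exact .inl (mem_insert _ _)
    · exact .inr (mem_insert _ _)
  · exact .inl (.inr (hclosed₁ A hA C hC hd))
  · exact .inr (.inr (hclosed₂ A hA C hC hd))

theorem Brick.lo_mem_solid (B : Brick) : B.lo ∈ B.solid := left_mem_Icc.2 fun n ↦ (B.lo_lt_hi n).le

theorem isClosed_solidOf (hQ : Q.Finite) : IsClosed (solidOf Q) :=
  hQ.isClosed_biUnion fun _ _ ↦ isClosed_Icc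

theorem eq_of_isConnected_solidOf {S : Set Brick} (hQ : Q.Finite) (hconn : IsConnected (solidOf Q))
    (hS : S ⊆ Q) (hne : S.Nonempty)
    (hdisj : ∀ A ∈ S, ∀ C ∈ Q, C ∉ S → Disjoint A.solid C.solid) : S = Q := by
  refine hS.antisymm fun C hC ↦ ?_
  by_contra hCS
  obtain ⟨A, hA⟩ := hne
  have hcover : solidOf Q ⊆ solidOf S ∪ solidOf (Q \ S) := by
    rw [← solidOf_union, union_sdiff_cancel hS]
  obtain ⟨p, -, hpS, hpQ⟩ := isPreconnected_closed_iff.1 hconn.isPreconnected _ _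
    (isClosed_solidOf (hQ.subset hS)) (isClosed_solidOf hQ.sdiff) hcover
    ⟨A.lo, mem_solidOf.2 ⟨A, hS hA, A.lo_mem_solid⟩, mem_solidOf.2 ⟨A, hA, A.lo_mem_solid⟩⟩
    ⟨C.lo, mem_solidOf.2 ⟨C, hC, C.lo_mem_solid⟩, mem_solidOf.2 ⟨C, ⟨hC, hCS⟩, C.lo_mem_solid⟩⟩
  obtain ⟨A, hA, hpA⟩ := mem_solidOf.1 hpS
  obtain ⟨C, ⟨hC, hCS⟩, hpC⟩ := mem_solidOf.1 hpQ
  exact disjoint_left.1 (hdisj A hA C hC hCS) hpA hpC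

theorem CastleFamily.exists_castleOn (H : CastleFamily d Q B₀) (hE : contactEdges Q ⊆ E) :
    ∃ T k, CastleOn E d B₀ T k ∧ Q = insert B₀ T := by
  obtain ⟨T, k, hT, hTQ, hclosed⟩ := H.exists_castleOn_closed hE H.base_mem
  have hsub : insert B₀ T ⊆ Q := insert_subset H.base_mem hTQ
  refine ⟨T, k, hT, (eq_of_isConnected_solidOf H.primitiveFamily.finite H.isConnected hsub
    (insert_nonempty _ _) fun A hA C hC hCT ↦ ?_).symm⟩
  refine (H.primitiveFamily.touch A (hsub hA) C hC fun h ↦ hCT (h ▸ hA)).resolve_right ?_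
  rintro ⟨d', hd'⟩
  obtain rfl | rfl := Bool.eq_or_eq_not d' d
  · exact hCT (.inr (hclosed A hA C hC hd'))
  · have hCA : C.AttachedAt A d := by simpa using hd'.symm
    rcases hA with rfl | hA
    · linarith [hCA.1, H.base C hC, C.support_add_support_not_pos 2 d]
    · obtain ⟨P, hP, hPA⟩ := hT.exists_parent hA
      exact hCT (H.parent_unique hC (hsub hP) (hTQ hA) hCA hPA ▸ hP)

theorem CastleFamily.ncard_contacts (H : CastleFamily d (insert B T) B) (hT : CastleOn E d B T k) :
    (contacts d (insert B T)).ncard = 2 * k := by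
  have himage : Prod.snd '' contacts d (insert B T) = T := by
    ext C
    constructor
    · rintro ⟨⟨A, C⟩, ⟨hA, hC, hAC⟩, rfl⟩
      refine hC.resolve_left ?_
      rintro rfl
      linarith [hAC.1, H.base A hA, A.support_add_support_not_pos 2 d]
    · intro hC
      obtain ⟨A, hA, hAC⟩ := hT.exists_parent hC
      exact ⟨(A, C), ⟨hA, .inr hC, hAC⟩, rfl⟩
  have hinj : InjOn Prod.snd (contacts d (insert B T)) := by
    rintro ⟨A, C⟩ ⟨hA, hC, hAC⟩ ⟨A', _⟩ ⟨hA', -, hAC'⟩ rfl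
    exact Prod.ext (H.parent_unique hA hA' hC hAC hAC') rfl
  rw [← hinj.ncard_image, himage, hT.finite_and_ncard.2]

end Tree

section Families

/-- `Q` and `Q'` are the collections of bricks of two castles with base bricks `N` and `W`, growing
in opposite directions and attached to each other at their base bricks, where `N` is the narrower
one. -/
structure DoubleCastleFamily (d : Bool) (Q : Set Brick) (N : Brick) (Q' : Set Brick)
    (W : Brick) : Prop where
  narrow : CastleFamily d Q N
  wide : CastleFamily (!d) Q' W
  contact : ∃ i j c, ReflexContact W N d i j c

variable {A A' B N W : Brick} {Q Q' : Set Brick} {d e : Bool}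

theorem CastleFamily.support_lt (H : CastleFamily d Q B) (hA : A ∈ Q) (hne : A ≠ B) :
    A.support 2 (!d) < B.support 2 (!d) := by
  obtain ⟨T, k, hT, rfl⟩ := H.exists_castleOn subset_rfl
  exact hT.support_lt (hA.resolve_left hne)

theorem DoubleCastleFamily.eq_of_support_nonneg (H : DoubleCastleFamily d Q N Q' W) (hA : A ∈ Q)
    (hA' : A' ∈ Q') (h : 0 ≤ A.support 2 (!d) + A'.support 2 d) : A = N ∧ A' = W := by
  obtain ⟨i, j, c, hc⟩ := H.contact
  have hle := H.narrow.base A hA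
  have hle' := H.wide.base A' hA'
  rw [Bool.not_not] at hle'
  constructor <;> by_contra hne
  · linarith [hc.attachedAt.1, H.narrow.support_lt hA hne]
  · have hlt := H.wide.support_lt hA' hne
    rw [Bool.not_not] at hlt
    linarith [hc.attachedAt.1]

theorem DoubleCastleFamily.eq_of_attachedAt (H : DoubleCastleFamily d Q N Q' W) (hA : A ∈ Q)
    (hA' : A' ∈ Q') (h : A'.AttachedAt A e) : e = d ∧ A = N ∧ A' = W := by
  have hnonneg : 0 ≤ A.support 2 (!d) + A'.support 2 d := by
    have h2 := h.1
    obtain rfl | rfl := Bool.eq_or_eq_not e d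
    · linarith
    · rw [Bool.not_not] at h2
      linarith [A.support_add_support_not_pos 2 d, A'.support_add_support_not_pos 2 d]
  obtain ⟨rfl, rfl⟩ := H.eq_of_support_nonneg hA hA' hnonneg
  obtain ⟨i, j, c, hc⟩ := H.contact
  exact ⟨h.dir_eq hc.attachedAt, rfl, rfl⟩

theorem DoubleCastleFamily.disjoint (H : DoubleCastleFamily d Q N Q' W) : Disjoint Q Q' := by
  refine disjoint_left.2 fun A hA hA' ↦ ?_
  obtain ⟨i, j, c, hc⟩ := H.contact
  have hpos := A.support_add_support_not_pos 2 d
  obtain ⟨rfl, rfl⟩ := H.eq_of_support_nonneg hA hA' (by linarith)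
  exact hc.attachedAt.ne rfl

theorem DoubleCastleFamily.disjoint_or_attachedAt (H : DoubleCastleFamily d Q N Q' W) (hA : A ∈ Q)
    (hA' : A' ∈ Q') : Disjoint A.solid A'.solid ∨ A'.AttachedAt A d := by
  refine or_iff_not_imp_left.2 fun hmeet ↦ ?_
  obtain ⟨p, hp, hp'⟩ := not_disjoint_iff.1 hmeet
  have hnonneg := Brick.support_add_support_not_nonneg hp hp' 2 (!d)
  rw [Bool.not_not] at hnonneg
  obtain ⟨rfl, rfl⟩ := H.eq_of_support_nonneg hA hA' hnonneg
  obtain ⟨i, j, c, hc⟩ := H.contact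
  exact hc.attachedAt

theorem DoubleCastleFamily.primitiveFamily (H : DoubleCastleFamily d Q N Q' W) :
    PrimitiveFamily (Q ∪ Q') := by
  obtain ⟨i, j, c, hc⟩ := H.contact
  refine ⟨H.narrow.primitiveFamily.finite.union H.wide.primitiveFamily.finite, ?_, ?_⟩
  · rintro A (hA | hA) B (hB | hB) hne
    · exact H.narrow.primitiveFamily.touch A hA B hB hne
    · exact (H.disjoint_or_attachedAt hA hB).imp_right fun h ↦ ⟨_, h.symm⟩
    · exact (H.disjoint_or_attachedAt hB hA).imp (fun h ↦ h.symm) fun h ↦ ⟨_, h⟩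
    · exact H.wide.primitiveFamily.touch A hA B hB hne
  · rintro A (hA | hA) B (hB | hB) e h
    · exact H.narrow.primitiveFamily.primitive A hA B hB e h
    · obtain ⟨rfl, rfl, rfl⟩ := H.eq_of_attachedAt hA hB h.symm
      exact ⟨i, j, c, .inr hc⟩
    · obtain ⟨rfl, rfl, rfl⟩ := H.eq_of_attachedAt hB hA h
      exact ⟨i, j, c, .inl hc⟩
    · exact H.wide.primitiveFamily.primitive A hA B hB e h

theorem DoubleCastleFamily.contacts_union (H : DoubleCastleFamily d Q N Q' W) :
    contacts d (Q ∪ Q') = insert (W, N) (contacts d Q ∪ contacts d Q') := by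
  obtain ⟨i, j, c, hc⟩ := H.contact
  ext ⟨A, B⟩
  constructor
  · rintro ⟨hA | hA, hB | hB, h⟩
    · exact .inr (.inl ⟨hA, hB, h⟩)
    · exact absurd (H.eq_of_attachedAt hA hB h.symm).1 (Bool.not_ne_self d)
    · obtain ⟨-, rfl, rfl⟩ := H.eq_of_attachedAt hB hA h
      exact mem_insert _ _
    · exact .inr (.inr ⟨hA, hB, h⟩)
  · rintro (⟨rfl, rfl⟩ | ⟨hA, hB, h⟩ | ⟨hA, hB, h⟩)
    · exact ⟨.inr H.wide.base_mem, .inl H.narrow.base_mem, hc.attachedAt⟩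
    · exact ⟨.inl hA, .inl hB, h⟩
    · exact ⟨.inr hA, .inr hB, h⟩

theorem DoubleCastleFamily.ncard_contacts_union (H : DoubleCastleFamily d Q N Q' W) :
    (contacts d (Q ∪ Q')).ncard = (contacts d Q).ncard + (contacts d Q').ncard + 1 := by
  have hfin := H.narrow.primitiveFamily.finite_contacts d
  have hfin' := H.wide.primitiveFamily.finite_contacts d
  have hdisj : Disjoint (contacts d Q) (contacts d Q') :=
    disjoint_left.2 fun x hx hx' ↦ disjoint_left.1 H.disjoint hx.1 hx'.1
  have hnew : (W, N) ∉ contacts d Q ∪ contacts d Q' := by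
    rintro (h | h)
    · exact disjoint_left.1 H.disjoint h.1 H.wide.base_mem
    · exact disjoint_left.1 H.disjoint H.narrow.base_mem h.2.1
  rw [H.contacts_union, ncard_insert_of_notMem hnew (hfin.union hfin'),
    ncard_union_eq hdisj hfin hfin']

theorem contactEdges_mono (h : Q ⊆ Q') : contactEdges Q ⊆ contactEdges Q' := by
  rintro e ⟨W, hW, N, hN, hcontact⟩
  exact ⟨W, h hW, N, h hN, hcontact⟩

theorem DoubleCastleFamily.exists_doubleCastleOn (H : DoubleCastleFamily d Q N Q' W) :
    ∃ i j c T k T' k', (contactEdges (Q ∪ Q')).ncard = 2 * (k + k') + 1 ∧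
      Q = insert N T ∧ Q' = insert W T' ∧
      DoubleCastleOn (solidOf (Q ∪ Q')) (contactEdges (Q ∪ Q')) d i j c N T k W T' k' := by
  obtain ⟨i, j, c, hc⟩ := H.contact
  have hE : contactEdges Q ⊆ contactEdges (Q ∪ Q') := contactEdges_mono subset_union_left
  have hE' : contactEdges Q' ⊆ contactEdges (Q ∪ Q') := contactEdges_mono subset_union_right
  obtain ⟨T, k, hT, rfl⟩ := H.narrow.exists_castleOn hE
  obtain ⟨T', k', hT', rfl⟩ := H.wide.exists_castleOn hE'
  refine ⟨i, j, c, T, k, T', k', ?_, rfl, rfl, hT, hT', ?_, ?_, ?_, hc.pushedIn,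
    W, .inr H.wide.base_mem, N, .inl H.narrow.base_mem, d, i, j, c, hc, rfl⟩
  · rw [H.primitiveFamily.ncard_contactEdges d, H.ncard_contacts_union, H.narrow.ncard_contacts hT,
      ← ncard_contacts_not d, H.wide.ncard_contacts hT']
    ring
  · rw [solidOf_union]
    exact subset_union_left
  · rw [solidOf_union]
    exact subset_union_right
  · rw [add_comm, hc.attachedAt.1]

theorem LitWith.exists_guardedByOpen {D : Set Pt} {E : Set (Pt × Pt)} {m : ℕ}
    (h : LitWith D E ∅ m D) : ∃ G ⊆ E, G.ncard ≤ m ∧ GuardedByOpen D G := by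
  obtain ⟨G, hG, hcard, hlit⟩ := h
  refine ⟨G, hG, hcard, fun y hy ↦ ?_⟩
  obtain ⟨x, hx, hxy⟩ := hlit y hy
  rw [empty_union] at hx
  obtain ⟨e, he, hxe⟩ := mem_iUnion₂.1 hx
  exact ⟨e, he, x, hxe, hxy⟩

theorem DoubleCastleFamily.exists_guards (H : DoubleCastleFamily d Q N Q' W) :
    ∃ k, (contactEdges (Q ∪ Q')).ncard = 2 * k + 1 ∧ ∃ G ⊆ contactEdges (Q ∪ Q'),
      G.ncard ≤ k + 1 ∧ GuardedByOpen (solidOf (Q ∪ Q')) G := by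
  obtain ⟨i, j, c, T, k, T', k', hcard, hQ, hQ', hdouble⟩ := H.exists_doubleCastleOn
  have hlit := hdouble.litWith
  rw [← hQ, ← hQ', ← solidOf_union] at hlit
  exact ⟨k + k', hcard, hlit.exists_guardedByOpen⟩

end Families

section Castle

variable {A B : Brick} {C : Set Pt} {Q : Set Brick}

theorem Brick.sitsOn_iff : B.SitsOn A ↔ A.AttachedAt B true := by
  simp only [SitsOn, AttachedAt, Bool.not_true, support_true, support_false, Bool.forall_bool,
    Bool.not_false, max_lt_iff, lt_min_iff, B.lo_lt_hi, A.lo_lt_hi, true_and, and_true]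
  refine and_congr (by rw [← sub_eq_add_neg, sub_eq_zero]) (forall₂_congr fun n _ ↦ ?_)
  rw [← sub_eq_add_neg, sub_pos, neg_add_eq_sub, sub_pos, and_comm]

theorem Brick.NarrowerThan.exists_pushedIn (h : B.NarrowerThan A) :
    ∃ i j c, B.PushedIn A i j c ∧ B.support i c < A.support i c := by
  obtain ⟨i, j, hi, hj, hij, hlo, hhi, ⟨hflush, hlt⟩ | ⟨hlt, hflush⟩⟩ := h
  · refine ⟨i, j, true, ⟨⟨hi, hj, hij⟩, ?_, ?_, ?_⟩, ?_⟩ <;>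
      simp [Bool.forall_bool, support_true, support_false, *, hlt.le]
  · refine ⟨i, j, false, ⟨⟨hi, hj, hij⟩, ?_, ?_, ?_⟩, ?_⟩ <;>
      simp [Bool.forall_bool, support_true, support_false, *, hlt.le]

theorem PrimitiveContact.exists_reflexContact (h : PrimitiveContact A B) :
    ∃ i j c, ReflexContact A B true i j c ∨ ReflexContact B A false i j c := by
  have hAB : A.AttachedAt B true := Brick.sitsOn_iff.1 h.1
  rcases h.2 with hn | hn
  · obtain ⟨i, j, c, hc, hlt⟩ := hn.exists_pushedIn
    exact ⟨i, j, c, .inl ⟨hAB, hc, hlt⟩⟩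
  · obtain ⟨i, j, c, hc, hlt⟩ := hn.exists_pushedIn
    exact ⟨i, j, c, .inr ⟨hAB.symm, hc, hlt⟩⟩

theorem IsBrickPartition.solidOf_eq (h : IsBrickPartition C Q) : solidOf Q = C := h.union_eq

theorem IsStack.primitiveFamily (h : IsStack C Q) : PrimitiveFamily Q where
  finite := h.finite
  touch A hA B hB hAB := (h.touch A hA B hB hAB).imp_right <| Or.rec
    (fun hd ↦ ⟨true, Brick.sitsOn_iff.1 hd⟩) fun hd ↦ ⟨false, (Brick.sitsOn_iff.1 hd).symm⟩
  primitive A hA B hB d hd := by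
    cases d with
    | true => exact (h.primitive A hA B hB (Brick.sitsOn_iff.2 hd)).exists_reflexContact
    | false =>
      obtain ⟨i, j, c, hc⟩ :=
        (h.primitive B hB A hA (Brick.sitsOn_iff.2 hd.symm)).exists_reflexContact
      exact ⟨i, j, c, hc.symm⟩

theorem IsCastle.castleFamily (h : IsCastle C Q) (hB : IsBaseBrick Q B) :
    CastleFamily true Q B where
  primitiveFamily := h.primitiveFamily
  isConnected := h.solidOf_eq ▸ h.connected
  zero_or_two A hA := by simpa only [Brick.sitsOn_iff] using h.zero_or_two A hA
  base_mem := hB.1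
  base A hA := by simpa [Brick.support_false] using hB.2 A hA

end Castle

section Turn

variable {A B N W : Brick} {Q : Set Brick} {i j n : Fin 3} {b c d : Bool}

/-- The side to which turning upside down takes the face on the side `b` orthogonal to the
direction `n`. -/
def turnSide (n : Fin 3) (b : Bool) : Bool := if n = 0 then b else !b

theorem turnSide_not (n : Fin 3) (b : Bool) : turnSide n (!b) = !turnSide n b := by
  unfold turnSide
  split_ifs <;> rfl

theorem turnSide_turnSide (n : Fin 3) (b : Bool) : turnSide n (turnSide n b) = b := by
  unfold turnSide
  split_ifs <;> simp

theorem Brick.support_turn (B : Brick) (n : Fin 3) (b : Bool) :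
    B.turn.support n b = B.support n (turnSide n b) := by
  fin_cases n <;> cases b <;> simp [turnSide, support, side, orient, turn]

theorem Brick.turn_turn (B : Brick) : B.turn.turn = B :=
  eq_of_support_eq fun n b ↦ by rw [support_turn, support_turn, turnSide_turnSide]

theorem Brick.turn_injective : Function.Injective Brick.turn :=
  Function.LeftInverse.injective turn_turn

theorem Brick.AttachedAt.turn (h : A.AttachedAt B d) : A.turn.AttachedAt B.turn (!d) := by
  refine ⟨?_, fun n hn b ↦ ?_⟩
  · simpa [Brick.support_turn, turnSide] using h.1
  · simpa only [Brick.support_turn, turnSide_not] using h.2 n hn (turnSide n b)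

theorem Brick.attachedAt_turn : A.turn.AttachedAt B.turn (!d) ↔ A.AttachedAt B d :=
  ⟨fun h ↦ by simpa only [turn_turn, Bool.not_not] using h.turn, AttachedAt.turn⟩

theorem Brick.PushedIn.turn (h : B.PushedIn A i j c) :
    B.turn.PushedIn A.turn i j (turnSide i c) := by
  refine ⟨h.pair, fun b ↦ ?_, ?_, ?_⟩
  · simpa only [Brick.support_turn] using h.across (turnSide j b)
  · simpa only [Brick.support_turn, turnSide_not, turnSide_turnSide] using h.flush
  · simpa only [Brick.support_turn, turnSide_turnSide] using h.pushed

theorem ReflexContact.turn (h : ReflexContact W N d i j c) :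
    ReflexContact W.turn N.turn (!d) i j (turnSide i c) := by
  refine ⟨h.attachedAt.turn, h.pushedIn.turn, ?_⟩
  simpa only [Brick.support_turn, turnSide_turnSide] using h.strict

theorem solidOf_image_turn (Q : Set Brick) : solidOf (Brick.turn '' Q) = turn '' solidOf Q := by
  simp only [solidOf, biUnion_image, Brick.solid_turn, image_iUnion]

theorem continuous_turn : Continuous turn := by
  unfold turn
  fun_prop

theorem turn_injective : Function.Injective turn := fun p q h ↦ by
  simpa [turn, funext_iff, Fin.forall_fin_succ] using h

theorem PrimitiveFamily.turn (h : PrimitiveFamily Q) : PrimitiveFamily (Brick.turn '' Q) where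
  finite := h.finite.image _
  touch := by
    rintro _ ⟨A, hA, rfl⟩ _ ⟨B, hB, rfl⟩ hAB
    simp only [Brick.solid_turn, disjoint_image_iff turn_injective]
    exact (h.touch A hA B hB (ne_of_apply_ne _ hAB)).imp_right fun ⟨_, hd⟩ ↦ ⟨_, hd.turn⟩
  primitive := by
    rintro _ ⟨A, hA, rfl⟩ _ ⟨B, hB, rfl⟩ d hd
    rw [← Bool.not_not d, Brick.attachedAt_turn] at hd
    obtain ⟨i, j, c, h | h⟩ := h.primitive A hA B hB _ hd
    · exact ⟨i, j, _, .inl (by simpa using h.turn)⟩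
    · exact ⟨i, j, _, .inr (by simpa using h.turn)⟩

theorem CastleFamily.turn (h : CastleFamily d Q B) :
    CastleFamily (!d) (Brick.turn '' Q) B.turn where
  primitiveFamily := h.primitiveFamily.turn
  isConnected := solidOf_image_turn Q ▸ h.isConnected.image _ continuous_turn.continuousOn
  zero_or_two := by
    rintro _ ⟨A, hA, rfl⟩
    have : {B ∈ Brick.turn '' Q | A.turn.AttachedAt B (!d)} =
        Brick.turn '' {B ∈ Q | A.AttachedAt B d} := by
      ext B
      constructor
      · rintro ⟨⟨B, hB, rfl⟩, h⟩
        exact ⟨B, ⟨hB, Brick.attachedAt_turn.1 h⟩, rfl⟩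
      · rintro ⟨B, ⟨hB, h⟩, rfl⟩
        exact ⟨⟨B, hB, rfl⟩, h.turn⟩
    rw [this, ncard_image_of_injective _ Brick.turn_injective]
    exact h.zero_or_two A hA
  base_mem := mem_image_of_mem _ h.base_mem
  base := by
    rintro _ ⟨A, hA, rfl⟩
    simpa [Brick.support_turn, turnSide] using h.base A hA

end Turn

theorem IsDoubleCastle.exists_family {D : Set Pt} (hD : IsDoubleCastle D) :
    ∃ d Q N Q' W, DoubleCastleFamily d Q N Q' W ∧ D = solidOf (Q ∪ Q') := by
  obtain ⟨C₁, C₂, Q₁, Q₂, B₁, B₂, h₁, hB₁, h₂, hB₂, hcontact, rfl⟩ := hD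
  have H₁ := h₁.castleFamily hB₁
  have H₂ := (h₂.castleFamily hB₂).turn
  have hsolid : C₁ ∪ turn '' C₂ = solidOf Q₁ ∪ solidOf (Brick.turn '' Q₂) := by
    rw [solidOf_image_turn, h₁.solidOf_eq, h₂.solidOf_eq]
  obtain ⟨i, j, c, hc | hc⟩ := hcontact.exists_reflexContact
  · exact ⟨true, _, _, _, _, ⟨H₁, H₂, i, j, c, hc⟩, by rw [hsolid, solidOf_union]⟩
  · exact ⟨false, _, _, _, _, ⟨H₂, H₁, i, j, c, hc⟩, by rw [hsolid, solidOf_union, union_comm]⟩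

theorem IsDoubleCastle.exists_guards {D : Set Pt} (hD : IsDoubleCastle D) :
    (reflexEdges D).Finite ∧ ∃ k, (reflexEdges D).ncard = 2 * k + 1 ∧
      ∃ G ⊆ reflexEdges D, G.ncard ≤ k + 1 ∧ GuardedByOpen D G := by
  obtain ⟨d, Q, N, Q', W, H, rfl⟩ := hD.exists_family
  rw [H.primitiveFamily.reflexEdges_eq]
  exact ⟨H.primitiveFamily.finite_contactEdges, H.exists_guards⟩

theorem GuardedByOpen.guardedByClosed {P : Set Pt} {G : Set (Pt × Pt)} (h : GuardedByOpen P G) :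
    GuardedByClosed P G := fun y hy ↦ by
  obtain ⟨e, he, x, hx, hxy⟩ := h y hy
  exact ⟨e, he, x, openSegment_subset_segment ℝ _ _ hx, hxy⟩

end OrthoPoly

theorem lemmal4 (D : Set OrthoPoly.Pt) (hD : OrthoPoly.IsDoubleCastle D) :
    (OrthoPoly.reflexEdges D).Finite ∧
    Odd (OrthoPoly.reflexEdges D).ncard ∧
    (∃ G ⊆ OrthoPoly.reflexEdges D,
      G.ncard ≤ (OrthoPoly.reflexEdges D).ncard / 2 + 1 ∧ OrthoPoly.GuardedByClosed D G) ∧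
    (∃ G ⊆ OrthoPoly.reflexEdges D,
      G.ncard ≤ (OrthoPoly.reflexEdges D).ncard / 2 + 1 ∧ OrthoPoly.GuardedByOpen D G) := by
  obtain ⟨hfinite, k, hcard, G, hG, hGk, hguard⟩ := hD.exists_guards
  have hbound : G.ncard ≤ (OrthoPoly.reflexEdges D).ncard / 2 + 1 := by omega
  exact ⟨hfinite, ⟨k, hcard⟩, ⟨G, hG, hbound, hguard.guardedByClosed⟩, G, hG, hbound, hguard⟩
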